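/- **Setting.** Let $V$ be a finite set and let $X=(X_j)_{j\in V}$ take values in $\prod_j\Omega_j$, where the $\Omega_j$ are standard Borel spaces with $\sigma$-finite reference measures $\mu_j$; write $\mu_A=\bigotimes_{j\in A}\mu_j$. A *chain graph* on $V$ has undirected and directed edges and no semi-directed cycle (following an arrow $u\to v$, one cannot return to $u$ along undirected edges and forward arrows). Its *chain components* $\tau\in\mathcal T$ are the connected components of the undirected part; $\mathrm{pa}(\tau)$ is the set of all parents of vertices of $\tau$. A *causal chain graph* is a chain graph with a splitting $\mathcal T=\mathcal T_{\rm confounding}\sqcup\mathcal T_{\overline{\rm confounding}}$ and a generative process for each component $\tau$, given the values $x_{\mathrm{pa}(\tau)}$ of its parents: * *confounding*: a hidden variable $Z_\tau$ is drawn from a law given $x_{\mathrm{pa}(\tau)}$; then the $X_j$, $j\in\tau$, are drawn independently of each other given $(x_{\mathrm{pa}(\tau)},Z_\tau)$, each from its own kernel; * *mutual interaction*: $X_\tau$ is in equilibrium (has a stationary distribution) under the dynamic process in which each $X_j$, $j\in\tau$, is updated at the ticks of a Poisson clock of positive rate by drawing from an update kernel given $x_{\mathrm{pa}(\tau)}$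 and the current $X_{\tau\setminus j}$; each update law is mutually absolutely continuous with $\mu_j$. The intervention $do(x_S)$, $S\subseteq V$, replaces all draws and updates of $X_j$, $j\in S$, by the assignment $X_j:=x_j$ and leaves all other draws and updates unchanged. A probability measure $Q$ on $\prod_j\Omega_j$ is a law of $X$ under $do(x_S)$ if, for each $\tau$, the conditional law under $Q$ of $X_\tau$ given all variables that are not in $\tau$ and not descendants of $\tau$ depends only on $X_{\mathrm{pa}(\tau)}$ and is, for almost every value of the parents, the law (respectively a stationary distribution) produced by the process of $\tau$ subject to the assignments. The observational law $P$ is a law of $X$ without intervention ($S=\emptyset$). Assume that for mutual-interaction components the update kernel of $X_j$ is the conditional law $P(X_j\mid X_{\tau\setminus j},X_{\mathrm{pa}(\tau)})$ (Gibbs updates), and that $P$ has a positive density, i.e. $P$ and $\mu_V$ are mutually absolutely continuous. Below, $P(X_A\mid x_B)$ denotes the conditional density $p_{A\cup B}/p_B$, where $p_A$ is the density of $P(X_A)$ with respect to $\mu_A$. **Theorem.** Let $S\subseteq V$ and $\bar S=V\setminus S$. For $\mu_S$-almost every $x_S$ there is exactly one law of $X$ under $do(x_S)$. Under it $X_S=x_S$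 almost surely, and $P(X_{\bar S}\mid do(x_S))$ has the density with respect to $\mu_{\bar S}$ $$P(X_{\bar S}\mid do(x_S))=\prod_{\tau\in\mathcal T_{\rm confounding}}P\big(X_{\tau\cap\bar S}\mid X_{\mathrm{pa}(\tau)\cap\bar S},x_{\mathrm{pa}(\tau)\cap S}\big)\times\prod_{\tau\in\mathcal T_{\overline{\rm confounding}}}P\big(X_{\tau\cap\bar S}\mid X_{\mathrm{pa}(\tau)\cap\bar S},x_{\mathrm{pa}(\tau)\cap S},x_{\tau\cap S}\big).$$ Consequently, for every measurable $f:\prod_j\Omega_j\to\mathbb R$, $f$ is integrable under $do(x_S)$ if and only if $f(\cdot,x_S)$ times this product of observational conditional densities is $\mu_{\bar S}$-integrable, and $\mathbb E[f(X)\mid do(x_S)]$ equals the integral over $x_{\bar S}$, with respect to $\mu_{\bar S}$, of $f(x_{\bar S},x_S)$ times this product (both sides being read as $0$ when $f$ is not integrable). -/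

import Mathlib

open MeasureTheory ProbabilityTheory
open scoped ENNReal NNReal

/-- A chain graph on the vertex set `V`: undirected edges (`line`), directed edges (`arrow`), and no
semi-directed cycle: after following an arrow `u → v`, no path that uses undirected edges (either
way) and arrows (forwards) leads from `v` back to `u`. -/
structure ChainGraph (V : Type*) where
  line : SimpleGraph V
  arrow : V → V → Prop
  acyclic : ∀ u v, arrow u v → ¬ Relation.ReflTransGen (fun a b => line.Adj a b ∨ arrow a b) v u

namespace ChainGraph

variable {V : Type*} [Fintype V] [DecidableEq V]

/-- `v` can be reached from `u` along undirected edges and arrows. -/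
def Leads (G : ChainGraph V) (u v : V) : Prop :=
  Relation.ReflTransGen (fun a b => G.line.Adj a b ∨ G.arrow a b) u v

open Classical in
/-- The chain component of `v`: everything connected to `v` by undirected edges. -/
noncomputable def component (G : ChainGraph V) (v : V) : Finset V :=
  {w | G.line.Reachable v w}

/-- The set of all chain components. -/
noncomputable def components (G : ChainGraph V) : Finset (Finset V) :=
  Finset.univ.image G.component

open Classical in
/-- The parents of a set `τ` of vertices (for a chain component they all lie outside `τ`). -/
noncomputable def pa (G : ChainGraph V) (τ : Finset V) : Finset V :=
  {u | ∃ v ∈ τ, G.arrow u v}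

open Classical in
/-- The vertices outside `τ` that are not descendants of `τ`. -/
noncomputable def nonDesc (G : ChainGraph V) (τ : Finset V) : Finset V :=
  {v | ¬ ∃ u ∈ τ, G.Leads u v}

end ChainGraph

/-- Joint values of the variables with index in `A`. -/
abbrev Vals {V : Type*} (Ω : V → Type*) (A : Finset V) : Type _ := ∀ i : A, Ω i

universe u v w

section Mechanisms

variable {V : Type u} [Fintype V] [DecidableEq V]

/-- The generative process of a component whose internal dependencies come from a common confounder:
given the parents of the component, a hidden variable with values in `Z` is drawn from `latent`, and
then, given the parents and the hidden variable, the variables of the component are drawn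
independently of each other, the `j`-th one from `draw j`. -/
structure ConfoundingMechanism (G : ChainGraph V) (Ω : V → Type v) [∀ j, MeasurableSpace (Ω j)]
    (τ : Finset V) where
  Z : Type w
  [instZ : MeasurableSpace Z]
  latent : Kernel (Vals Ω (G.pa τ)) Z
  draw : ∀ j : τ, Kernel (Vals Ω (G.pa τ) × Z) (Ω j)
  [latent_markov : IsMarkovKernel latent]
  [draw_markov : ∀ j, IsMarkovKernel (draw j)]

attribute [instance] ConfoundingMechanism.instZ ConfoundingMechanism.latent_markov
  ConfoundingMechanism.draw_markov

/-- The values of the variables in `τ` other than `j`. -/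
def others {Ω : V → Type*} {τ : Finset V} (j : τ) (y : Vals Ω τ) :
    ∀ i : {i : τ // i ≠ j}, Ω i := fun i => y i

/-- The generative process of a component whose variables interact with each other: as time goes by,
each variable `j` of the component is updated again and again, at the ticks of a Poisson clock of
rate `rate j`, by drawing a new value from `update j`, given the values of the parents of the
component and the current values of the other variables in the component. Every update has a
strictly positive density with respect to the reference measure. -/
structure InteractionMechanism (G : ChainGraph V) (Ω : V → Type*) [∀ j, MeasurableSpace (Ω j)]
    (μ : ∀ j, Measure (Ω j)) (τ : Finset V) where
  rate : τ → ℝ≥0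
  rate_pos : ∀ j, 0 < rate j
  update : ∀ j : τ, Kernel (Vals Ω (G.pa τ) × (∀ i : {i : τ // i ≠ j}, Ω i)) (Ω j)
  [update_markov : ∀ j, IsMarkovKernel (update j)]
  update_ac : ∀ (j : τ) x, update j x ≪ μ j
  ac_update : ∀ (j : τ) x, μ j ≪ update j x

attribute [instance] InteractionMechanism.update_markov

/-- A causal chain graph: a chain graph, a splitting of its chain components into those with
confounding and those with mutual interaction, and a generative process of the corresponding kind
for each component. -/
structure CausalChainGraph (V : Type u) [Fintype V] [DecidableEq V] (Ω : V → Type v)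
    [∀ j, MeasurableSpace (Ω j)] (μ : ∀ j, Measure (Ω j)) extends ChainGraph V where
  confounded : Finset (Finset V)
  confounded_subset : confounded ⊆ toChainGraph.components
  confounding : ∀ τ ∈ confounded, ConfoundingMechanism.{u, v, w} toChainGraph Ω τ
  interaction : ∀ τ ∈ toChainGraph.components \ confounded,
    InteractionMechanism toChainGraph Ω μ τ

variable {G : ChainGraph V} {Ω : V → Type*} [∀ j, MeasurableSpace (Ω j)]
  {μ : ∀ j, Measure (Ω j)} {τ : Finset V}

/-- The law of `X_τ`, for a component with confounding whose parents have the values `xpa`, when the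
variables in `S` are set to `xS`: draws of variables in `S` are replaced by assignments. -/
noncomputable def ConfoundingMechanism.response (m : ConfoundingMechanism G Ω τ)
    (S : Finset V) (xS : Vals Ω S) (xpa : Vals Ω (G.pa τ)) : Measure (Vals Ω τ) :=
  (m.latent xpa).bind fun z => Measure.pi fun j : τ =>
    if h : (j : V) ∈ S then Measure.dirac (xS ⟨j, h⟩) else m.draw j (xpa, z)

/-- The law of the next state when variable `j` is updated in state `y`, when the variables in `S`
are set to `xS`: updates of variables in `S` are replaced by assignments. -/
noncomputable def InteractionMechanism.step (m : InteractionMechanism G Ω μ τ)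
    (S : Finset V) (xS : Vals Ω S) (xpa : Vals Ω (G.pa τ)) (j : τ) (y : Vals Ω τ) :
    Measure (Vals Ω τ) :=
  if h : (j : V) ∈ S then Measure.dirac (Function.update y j (xS ⟨j, h⟩))
  else (m.update j (xpa, others j y)).map (Function.update y j)

/-- `π` is an equilibrium (stationary) distribution of the dynamic process of a component with mutual
interaction whose parents have the values `xpa`, when the variables in `S` are set to `xS`. -/
def InteractionMechanism.IsEquilibrium (m : InteractionMechanism G Ω μ τ)
    (S : Finset V) (xS : Vals Ω S) (xpa : Vals Ω (G.pa τ)) (π : Measure (Vals Ω τ)) : Prop :=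
  IsProbabilityMeasure π ∧
    ∑ j : τ, m.rate j • π.bind (m.step S xS xpa j) = (∑ j : τ, m.rate j) • π

end Mechanisms

section Laws

variable {V : Type*} [Fintype V] [DecidableEq V] {Ω : V → Type*} [∀ j, MeasurableSpace (Ω j)]
  {μ : ∀ j, Measure (Ω j)}

/-- Under the law `Q`, the component `τ` has conditional law `η (X_pa(τ))` given all its
non-descendants: replacing `X_τ` by a draw from `η` given the parents leaves the joint law of the
non-descendants and `X_τ` unchanged. -/
def DrawnFrom (G : ChainGraph V) (Q : Measure (∀ j, Ω j)) (τ : Finset V)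
    (η : Kernel (Vals Ω (G.pa τ)) (Vals Ω τ)) : Prop :=
  Q.map (fun x => ((G.nonDesc τ).restrict x, τ.restrict x)) =
    (Q ⊗ₘ η.comap (G.pa τ).restrict (Finset.measurable_restrict _)).map
      (fun p => ((G.nonDesc τ).restrict p.1, p.2))

/-- `Q` is the joint law of all variables in the causal chain graph when the variables in `S` are
set to `xS`: each component is generated, given its parents and independently of its other
non-descendants, by its own process, subject to the assignments that fall into it. -/
structure CausalChainGraph.IsDoLaw (C : CausalChainGraph V Ω μ) (S : Finset V) (xS : Vals Ω S)
    (Q : Measure (∀ j, Ω j)) : Prop where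
  prob : IsProbabilityMeasure Q
  confounding : ∀ τ, ∀ h : τ ∈ C.confounded, ∃ η : Kernel (Vals Ω (C.pa τ)) (Vals Ω τ),
    IsMarkovKernel η ∧ DrawnFrom C.toChainGraph Q τ η ∧
    ∀ᵐ x ∂Q, η ((C.pa τ).restrict x) = (C.confounding τ h).response S xS ((C.pa τ).restrict x)
  interaction : ∀ τ, ∀ h : τ ∈ C.components \ C.confounded,
    ∃ η : Kernel (Vals Ω (C.pa τ)) (Vals Ω τ),
    IsMarkovKernel η ∧ DrawnFrom C.toChainGraph Q τ η ∧
    ∀ᵐ x ∂Q, (C.interaction τ h).IsEquilibrium S xS ((C.pa τ).restrict x)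
      (η ((C.pa τ).restrict x))

/-- `P` is the observational law of the causal chain graph: it is generated by the undisturbed
processes, and the updates in components with mutual interaction are Gibbs updates, i.e. `update j`
is the conditional law under `P` of `X_j` given the parents and the other variables of the
component. -/
structure CausalChainGraph.IsObservationalLaw (C : CausalChainGraph V Ω μ)
    (P : Measure (∀ j, Ω j)) : Prop where
  generated : C.IsDoLaw ∅ (fun i => absurd i.2 (Finset.notMem_empty _)) P
  gibbs : ∀ τ, ∀ h : τ ∈ C.components \ C.confounded, ∀ j : τ,
    P.map (fun x => (((C.pa τ).restrict x, others j (τ.restrict x)), x j)) =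
      P.map (fun x => ((C.pa τ).restrict x, others j (τ.restrict x))) ⊗ₘ
        (C.interaction τ h).update j

/-- The density at `x` of the marginal law of `X_A` under `P`. -/
noncomputable def margDensity (μ : ∀ j, Measure (Ω j)) (P : Measure (∀ j, Ω j)) (A : Finset V)
    (x : ∀ j, Ω j) : ℝ≥0∞ :=
  (P.map A.restrict).rnDeriv (Measure.pi fun i : A => μ i) (A.restrict x)

/-- The conditional density at `x` of `X_A` given `X_B` under `P`, for disjoint `A` and `B`. -/
noncomputable def condDensity (μ : ∀ j, Measure (Ω j)) (P : Measure (∀ j, Ω j)) (A B : Finset V)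
    (x : ∀ j, Ω j) : ℝ≥0∞ :=
  margDensity μ P (A ∪ B) x / margDensity μ P B x

/-- The configuration with value `xS` on `S` and value `y` outside `S`. -/
def glue (S : Finset V) (xS : Vals Ω S) (y : Vals Ω Sᶜ) : ∀ j, Ω j := fun j =>
  if h : j ∈ S then xS ⟨j, h⟩ else y ⟨j, Finset.mem_compl.2 h⟩

/-- The right-hand side of the interventional formula, as a function of the values outside `S`. -/
noncomputable def CausalChainGraph.interventionalDensity (C : CausalChainGraph V Ω μ)
    (P : Measure (∀ j, Ω j)) (S : Finset V) (xS : Vals Ω S) (y : Vals Ω Sᶜ) : ℝ≥0∞ :=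
  (∏ τ ∈ C.confounded, condDensity μ P (τ ∩ Sᶜ) (C.pa τ) (glue S xS y)) *
    ∏ τ ∈ C.components \ C.confounded,
      condDensity μ P (τ ∩ Sᶜ) (C.pa τ ∪ (τ ∩ S)) (glue S xS y)

end Laws

/-!
Fix the assigned values `xS` and let `λ` be the product of the measures `doRef μ S xS j`: point
masses at `xS j` for `j ∈ S`, and `μ j` for the other variables. The law under the intervention is
`λ.withDensity (∏ τ, d τ)`, where `d τ` is the conditional density, under the observational law,
of the variables of `τ` outside `S`, given the parents of `τ` and, for a component with mutual
interaction, the variables in `τ ∩ S`. To have these conditional densities normalised at every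
point, they are computed from a positive joint density `p` by integrating out variables
(`margInt`, `condInt`); almost everywhere they agree with the quotients of Radon–Nikodym
derivatives (`margDensity_ae_eq`).

*The product is a law under the intervention.* Since `d τ` integrates to one over the variables of
`τ`, terminal components can be integrated out one after the other (`lmarginal_blockProd`), so
that each component is drawn from the kernel with density `d τ`, given its parents
(`drawnFrom_blockProd`). It remains to see that this kernel is produced by the process of the
component. With confounding, the draws are independent given the hidden variable, so that
replacing some of them by assignments only replaces the corresponding coordinates of the response,
and the others keep their observational conditional law
(`ConfoundingMechanism.response_eq_densityKernel`). With mutual interaction, each update that is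
left in place is a draw from the conditional density of one variable given the rest of the
component and the parents; by the tower property it leaves the conditional law given the parents
and the assigned variables invariant (`InteractionMechanism.isEquilibrium_densityKernel`). These
identities hold for almost every configuration with respect to `Measure.pi μ`, hence, by Fubini's
theorem, for almost every configuration with respect to `λ`, for almost all `xS`
(`ae_ae_pi_doRef`).

*It is the only one.* An equilibrium of the process of a component is unique for all values of the
parents: as every update law dominates the reference measure, each nonzero invariant measure
dominates the product of the measures `doRef μ S xS j`
(`InteractionMechanism.pi_doRef_absolutelyContinuous`), whereas the positive and negative parts of
the difference of two invariant probability measures are invariant and mutually singular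
(`invariant_unique`). Therefore the conditional law of each component given its parents is
determined, and two laws agree on all ancestral sets, by adding one terminal component at a time
(`eq_of_drawnFrom`).
-/

/-! ### Product measures: null sets and partial integration -/

section ProductCalculus

open Function

variable {V : Type*} [DecidableEq V] {Ω : V → Type*}

omit [DecidableEq V] in
lemma dependsOn_of_restrict {β : Type*} (A : Finset V) (f : Vals Ω A → β) :
    DependsOn (fun x : ∀ j, Ω j => f (A.restrict x)) (A : Set V) := fun x y h => by
  have : A.restrict x = A.restrict y := funext fun i => h i i.2
  simp only [this]

lemma updateFinset_eq_self_of_dependsOn {β : Type*} {f : (∀ j, Ω j) → β} {T : Set V}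
    (hf : DependsOn f T) {s : Finset V} (hs : ∀ i ∈ s, i ∉ T) (x : ∀ j, Ω j) (y : Vals Ω s) :
    f (updateFinset x s y) = f x :=
  hf fun i hi => by
    have : i ∉ s := fun h => hs i h hi
    simp [updateFinset_def, this]

omit [DecidableEq V] in
lemma DependsOn.mul' {f g : (∀ j, Ω j) → ℝ≥0∞} {T : Set V} (hf : DependsOn f T)
    (hg : DependsOn g T) : DependsOn (fun x => f x * g x) T := fun x y h => by
  simp only [hf h, hg h]

variable [∀ j, MeasurableSpace (Ω j)]

lemma DependsOn.lmarginal (ν : ∀ j, Measure (Ω j)) {f : (∀ j, Ω j) → ℝ≥0∞} {T U : Set V}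
    (hf : DependsOn f T) (s : Finset V) (hU : ∀ i ∈ T, i ∉ s → i ∈ U) :
    DependsOn (∫⋯∫⁻_s, f ∂ν) U := fun x y h => by
  simp only [MeasureTheory.lmarginal]
  congr 1
  ext z
  refine hf fun i hi => ?_
  by_cases his : i ∈ s
  · simp [updateFinset_def, his]
  · simpa [updateFinset_def, his] using h i (hU i hi his)

lemma Measurable.updateFinset_right {β : Type*} [MeasurableSpace β]
    {f : (∀ j, Ω j) → β} (hf : Measurable f) (s : Finset V) (x : ∀ j, Ω j) :
    Measurable fun y : Vals Ω s => f (updateFinset x s y) :=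
  hf.comp measurable_updateFinset

omit [DecidableEq V] in
lemma Measurable.restrict_left {β : Type*} [MeasurableSpace β]
    {s : Finset V} {f : Vals Ω s → β} (hf : Measurable f) :
    Measurable fun x : ∀ j, Ω j => f (s.restrict x) :=
  hf.comp (Finset.measurable_restrict _)

/-- A factor that does not depend on the integrated variables can be pulled out. -/
lemma lmarginal_mul_left (ν : ∀ j, Measure (Ω j)) {f g : (∀ j, Ω j) → ℝ≥0∞} {T : Set V}
    (hg : DependsOn g T) {s : Finset V} (hs : ∀ i ∈ s, i ∉ T) (hf : Measurable f) :
    ∫⋯∫⁻_s, (fun x => g x * f x) ∂ν = fun x => g x * (∫⋯∫⁻_s, f ∂ν) x := by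
  ext x
  simp only [lmarginal, updateFinset_eq_self_of_dependsOn hg hs]
  exact lintegral_const_mul _ (hf.comp measurable_updateFinset)

lemma lmarginal_congr_measure {ν μ : ∀ j, Measure (Ω j)} {s : Finset V}
    (h : ∀ j ∈ s, ν j = μ j) (f : (∀ j, Ω j) → ℝ≥0∞) :
    ∫⋯∫⁻_s, f ∂ν = ∫⋯∫⁻_s, f ∂μ := by
  ext x
  simp only [lmarginal]
  have : (fun i : s => ν i) = fun i : s => μ i := funext fun i => h i i.2
  rw [this]

lemma lmarginal_congr_of_ae (ν : ∀ j, Measure (Ω j)) {s : Finset V} {x : ∀ j, Ω j}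
    {f g : (∀ j, Ω j) → ℝ≥0∞}
    (h : ∀ᵐ y ∂(Measure.pi fun i : s => ν i), f (updateFinset x s y) = g (updateFinset x s y)) :
    (∫⋯∫⁻_s, f ∂ν) x = (∫⋯∫⁻_s, g ∂ν) x :=
  lintegral_congr_ae h

lemma lintegral_pi_finset (ν : ∀ j, Measure (Ω j)) (s : Finset V) (f : Vals Ω s → ℝ≥0∞)
    (x : ∀ j, Ω j) :
    ∫⁻ z, f z ∂(Measure.pi fun i : s => ν i) = (∫⋯∫⁻_s, (fun x => f (s.restrict x)) ∂ν) x := by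
  simp [lmarginal, restrict_updateFinset]

variable [Fintype V]

/-- Integration against a product measure, one block of variables after the other. -/
lemma lintegral_pi_eq_lmarginal (ν : ∀ j, Measure (Ω j)) [∀ j, SigmaFinite (ν j)]
    {f : (∀ j, Ω j) → ℝ≥0∞} (hf : Measurable f) (s : Finset V) (x : ∀ j, Ω j) :
    ∫⁻ x, f x ∂(Measure.pi ν) = (∫⋯∫⁻_s, ∫⋯∫⁻_sᶜ, f ∂ν ∂ν) x := by
  rw [lintegral_eq_lmarginal_univ x, ← lmarginal_union ν f hf disjoint_compl_right,
    Finset.union_compl]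

/-- Fubini for null sets: re-sampling the variables in `s` of a point chosen at random does not lead
into a null set. -/
lemma ae_ae_updateFinset (ν : ∀ j, Measure (Ω j)) [∀ j, SigmaFinite (ν j)]
    {φ : (∀ j, Ω j) → Prop} (h : ∀ᵐ x ∂(Measure.pi ν), φ x) (s : Finset V) :
    ∀ᵐ x ∂(Measure.pi ν), ∀ᵐ y ∂(Measure.pi fun i : s => ν i), φ (updateFinset x s y) := by
  rcases isEmpty_or_nonempty (∀ j, Ω j) with he | ⟨⟨x₀⟩⟩
  · exact Filter.Eventually.of_forall fun x => he.elim x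
  obtain ⟨N, hN, hNm, hN0⟩ := exists_measurable_superset_of_null (ae_iff.1 h)
  have hNi : Measurable (N.indicator (1 : (∀ j, Ω j) → ℝ≥0∞)) := measurable_one.indicator hNm
  have h0 : ∫⁻ x, N.indicator 1 x ∂(Measure.pi ν) = 0 := by rw [lintegral_indicator_one hNm, hN0]
  have h1 : ∫⁻ x, (∫⋯∫⁻_s, N.indicator 1 ∂ν) x ∂(Measure.pi ν) = 0 := by
    rw [lintegral_pi_eq_lmarginal ν (hNi.lmarginal ν) s x₀]
    have : ∀ x, (∫⋯∫⁻_sᶜ, ∫⋯∫⁻_s, N.indicator 1 ∂ν ∂ν) x = 0 := fun x => by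
      rw [← lmarginal_union' ν _ hNi disjoint_compl_right, Finset.union_compl,
        ← lintegral_eq_lmarginal_univ x, h0]
    rw [funext this]; simp [lmarginal]
  rw [lintegral_eq_zero_iff (hNi.lmarginal ν)] at h1
  filter_upwards [h1] with x hx
  have := (lintegral_eq_zero_iff (hNi.comp measurable_updateFinset)).1 hx
  filter_upwards [this] with y hy
  by_contra hφ
  have : updateFinset x s y ∈ N := hN hφ
  simp [this] at hy

lemma ae_pi_finset_of_ae (ν : ∀ j, Measure (Ω j)) [∀ j, SigmaFinite (ν j)]
    (h0 : Measure.pi ν ≠ 0) (s : Finset V)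
    {φ : Vals Ω s → Prop} (h : ∀ᵐ x ∂(Measure.pi ν), φ (s.restrict x)) :
    ∀ᵐ z ∂(Measure.pi fun i : s => ν i), φ z := by
  have : (ae (Measure.pi ν)).NeBot := ae_neBot.2 h0
  obtain ⟨x, hx⟩ := (ae_ae_updateFinset ν h s).exists
  simpa [restrict_updateFinset] using hx

lemma ae_comp_restrict_of_ae (ν : ∀ j, Measure (Ω j)) [∀ j, SigmaFinite (ν j)] (s : Finset V)
    {φ : Vals Ω s → Prop} (h : ∀ᵐ z ∂(Measure.pi fun i : s => ν i), φ z) :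
    ∀ᵐ x ∂(Measure.pi ν), φ (s.restrict x) := by
  rcases isEmpty_or_nonempty (∀ j, Ω j) with he | ⟨⟨x₀⟩⟩
  · exact Filter.Eventually.of_forall fun x => he.elim x
  obtain ⟨N, hN, hNm, hN0⟩ := exists_measurable_superset_of_null (ae_iff.1 h)
  have hNi : Measurable (N.indicator (1 : Vals Ω s → ℝ≥0∞)) := measurable_one.indicator hNm
  have hr : Measurable (s.restrict : (∀ j, Ω j) → Vals Ω s) := Finset.measurable_restrict _
  have h1 : ∫⁻ x, N.indicator 1 (s.restrict x) ∂(Measure.pi ν) = 0 := by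
    rw [lintegral_eq_lmarginal_univ x₀, ← Finset.union_compl sᶜ, compl_compl,
      lmarginal_union ν (fun x => N.indicator 1 (s.restrict x)) (hNi.comp hr)
        disjoint_compl_left]
    have : ∫⋯∫⁻_s, (fun x => N.indicator 1 (s.restrict x)) ∂ν = 0 := by
      ext x
      rw [← lintegral_pi_finset ν s (N.indicator 1) x, lintegral_indicator_one hNm, hN0]; rfl
    rw [this]
    simp [lmarginal]
  rw [lintegral_eq_zero_iff (f := fun x => N.indicator 1 (s.restrict x)) (hNi.comp hr)] at h1
  filter_upwards [h1] with x hx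
  by_contra hφ
  have : s.restrict x ∈ N := hN hφ
  simp [this] at hx

end ProductCalculus

/-! ### Marginal and conditional densities -/

section Densities

open Function

variable {V : Type*} [Fintype V] [DecidableEq V] {Ω : V → Type*} [∀ j, MeasurableSpace (Ω j)]

/-- The density of the variables in `A`, as a function on the full product: the joint density `p`
with all other variables integrated out. -/
noncomputable def margInt (μ : ∀ j, Measure (Ω j)) (p : (∀ j, Ω j) → ℝ≥0∞) (A : Finset V) :
    (∀ j, Ω j) → ℝ≥0∞ := ∫⋯∫⁻_Aᶜ, p ∂μ

/-- A version of the conditional density of the variables in `B` given those in `A` which is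
normalised at every point: where the density of `A` is infinite, the conditional density is replaced
by the unconditional one. -/
noncomputable def condInt (μ : ∀ j, Measure (Ω j)) (p : (∀ j, Ω j) → ℝ≥0∞) (B A : Finset V)
    (x : ∀ j, Ω j) : ℝ≥0∞ :=
  if margInt μ p A x = ∞ then margInt μ p B x else margInt μ p (A ∪ B) x / margInt μ p A x

variable {μ : ∀ j, Measure (Ω j)} [∀ j, SigmaFinite (μ j)] {p : (∀ j, Ω j) → ℝ≥0∞}
  {A B : Finset V}

lemma measurable_margInt (hp : Measurable p) : Measurable (margInt μ p A) := hp.lmarginal μ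

omit [∀ j, SigmaFinite (μ j)] in
lemma dependsOn_margInt : DependsOn (margInt μ p A) (A : Set V) :=
  DependsOn.lmarginal μ (dependsOn_univ p) Aᶜ fun i _ h => by simpa using h

lemma lmarginal_margInt (hp : Measurable p) (hAB : Disjoint A B) :
    ∫⋯∫⁻_B, margInt μ p (A ∪ B) ∂μ = margInt μ p A := by
  rw [margInt, margInt, ← lmarginal_union μ p hp]
  · congr 1
    ext i
    have : i ∈ A → i ∉ B := fun h => Finset.disjoint_left.1 hAB h
    simp only [Finset.mem_union, Finset.mem_compl]
    tauto
  · exact Finset.disjoint_left.2 fun i hi => by simp [hi]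

lemma lmarginal_margInt_self (hp : Measurable p) (x : ∀ j, Ω j) :
    (∫⋯∫⁻_A, margInt μ p A ∂μ) x = ∫⁻ x, p x ∂(Measure.pi μ) := by
  rw [lintegral_pi_eq_lmarginal μ hp A x]; rfl

omit [DecidableEq V] in
lemma pi_finset_ne_zero {ν : ∀ j, Measure (Ω j)} [∀ j, SigmaFinite (ν j)] (h : Measure.pi ν ≠ 0)
    (s : Finset V) :
    Measure.pi (fun i : s => ν i) ≠ 0 := by
  rw [Ne, ← Measure.measure_univ_eq_zero, Measure.pi_univ, Finset.prod_eq_zero_iff] at h ⊢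
  push Not at h ⊢
  exact fun i _ => h i (Finset.mem_univ _)

lemma margInt_ne_zero (hp : Measurable p) (hp0 : ∀ x, p x ≠ 0) (hμ : Measure.pi μ ≠ 0)
    (x : ∀ j, Ω j) : margInt μ p A x ≠ 0 := by
  rw [margInt, lmarginal, Ne, lintegral_eq_zero_iff (hp.updateFinset_right _ _)]
  intro h
  have : (ae (Measure.pi fun i : (Aᶜ : Finset V) => μ i)).NeBot :=
    ae_neBot.2 (pi_finset_ne_zero hμ _)
  obtain ⟨y, hy⟩ := h.exists
  exact hp0 _ hy

lemma measurable_condInt (hp : Measurable p) : Measurable (condInt μ p B A) :=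
  Measurable.ite (measurable_margInt hp (measurableSet_singleton ∞)) (measurable_margInt hp)
    ((measurable_margInt hp).div (measurable_margInt hp))

omit [∀ j, SigmaFinite (μ j)] in
lemma dependsOn_condInt : DependsOn (condInt μ p B A) ((A ∪ B : Finset V) : Set V) := by
  intro x y h
  have h1 := dependsOn_margInt (μ := μ) (p := p) (A := A) (x := x) (y := y)
    fun i hi => h i (by simp_all)
  have h2 := dependsOn_margInt (μ := μ) (p := p) (A := B) (x := x) (y := y)
    fun i hi => h i (by simp_all)
  simp only [condInt, h1, h2, dependsOn_margInt (μ := μ) (p := p) (A := A ∪ B) h]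

lemma lmarginal_condInt (hp : Measurable p) (hp0 : ∀ x, p x ≠ 0)
    (hp1 : ∫⁻ x, p x ∂(Measure.pi μ) = 1) (hAB : Disjoint A B) (x : ∀ j, Ω j) :
    (∫⋯∫⁻_B, condInt μ p B A ∂μ) x = 1 := by
  have hμ : Measure.pi μ ≠ 0 := fun h => by simp [h] at hp1
  have hB : ∀ y, margInt μ p A (updateFinset x B y) = margInt μ p A x := fun y =>
    updateFinset_eq_self_of_dependsOn dependsOn_margInt
      (fun i hi h => Finset.disjoint_left.1 hAB h hi) x y
  by_cases h : margInt μ p A x = ∞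
  · rw [← hp1, ← lmarginal_margInt_self (A := B) hp x]
    simp [lmarginal, condInt, hB, h]
  · simp only [lmarginal, condInt, hB, h, if_false, div_eq_mul_inv]
    rw [lintegral_mul_const _ ((measurable_margInt hp).updateFinset_right _ _)]
    have := congrFun (lmarginal_margInt (μ := μ) hp hAB) x
    simp only [lmarginal] at this
    rw [this, ENNReal.mul_inv_cancel (margInt_ne_zero hp hp0 hμ x) h]

omit [∀ j, SigmaFinite (μ j)] in
lemma condInt_of_ne_top {x : ∀ j, Ω j} (h : margInt μ p A x ≠ ∞) :
    condInt μ p B A x = margInt μ p (A ∪ B) x / margInt μ p A x := by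
  simp [condInt, h]

/-- Expectations of functions of the variables in `A` are integrals against the marginal density. -/
lemma lintegral_withDensity_of_dependsOn (hp : Measurable p) {F : (∀ j, Ω j) → ℝ≥0∞}
    (hF : Measurable F) (hFA : DependsOn F (A : Set V)) (x : ∀ j, Ω j) :
    ∫⁻ x, F x ∂((Measure.pi μ).withDensity p) =
      (∫⋯∫⁻_A, (fun x => F x * margInt μ p A x) ∂μ) x := by
  rw [lintegral_withDensity_eq_lintegral_mul _ hp hF, lintegral_pi_eq_lmarginal μ (hp.mul hF) A x]
  congr 1
  have : p * F = fun x => F x * p x := by ext; simp [mul_comm]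
  rw [this, lmarginal_mul_left μ hFA (by simp) hp]
  rfl

lemma map_restrict_withDensity (hp : Measurable p) (x₀ : ∀ j, Ω j) :
    ((Measure.pi μ).withDensity p).map A.restrict =
      (Measure.pi fun i : A => μ i).withDensity fun a => margInt μ p A (updateFinset x₀ A a) := by
  refine Measure.ext_of_lintegral _ fun f hf => ?_
  rw [lintegral_map hf (Finset.measurable_restrict _), lintegral_withDensity_of_dependsOn hp
    hf.restrict_left (dependsOn_of_restrict A f) x₀,
    lintegral_withDensity_eq_lintegral_mul _ ((measurable_margInt hp).updateFinset_right _ _)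
      hf]
  simp [lmarginal, restrict_updateFinset, mul_comm]

lemma margInt_ae_ne_top (hp : Measurable p) (hp1 : ∫⁻ x, p x ∂(Measure.pi μ) ≠ ∞)
    (A : Finset V) : ∀ᵐ x ∂(Measure.pi μ), margInt μ p A x ≠ ∞ := by
  rcases isEmpty_or_nonempty (∀ j, Ω j) with he | ⟨⟨x₀⟩⟩
  · exact Filter.Eventually.of_forall fun x => he.elim x
  have h := ae_lt_top (μ := Measure.pi fun i : A => μ i)
    ((measurable_margInt (μ := μ) (A := A) hp).comp (measurable_updateFinset (x := x₀) (s := A)))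
    (by rw [← lmarginal_margInt_self (A := A) hp x₀] at hp1; exact hp1)
  filter_upwards [ae_comp_restrict_of_ae μ A h] with x hx
  refine ne_of_lt (lt_of_eq_of_lt (dependsOn_margInt fun i hi => ?_) hx)
  simp [updateFinset_def, show i ∈ A from hi]

lemma margDensity_ae_eq (hp : Measurable p) (A : Finset V) :
    ∀ᵐ x ∂(Measure.pi μ), margDensity μ ((Measure.pi μ).withDensity p) A x = margInt μ p A x := by
  rcases isEmpty_or_nonempty (∀ j, Ω j) with he | ⟨⟨x₀⟩⟩
  · exact Filter.Eventually.of_forall fun x => he.elim x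
  have h := Measure.rnDeriv_withDensity (Measure.pi fun i : A => μ i)
    ((measurable_margInt (μ := μ) (A := A) hp).comp (measurable_updateFinset (x := x₀) (s := A)))
  filter_upwards [ae_comp_restrict_of_ae μ A h] with x hx
  rw [margDensity, map_restrict_withDensity hp x₀]
  refine hx.trans (dependsOn_margInt fun i hi => ?_)
  simp [updateFinset_def, show i ∈ A from hi]

omit [DecidableEq V] in
/-- The density may be taken positive everywhere: it vanishes on a null set only, where its value does
not matter. -/
lemma exists_pos_density {P : Measure (∀ j, Ω j)} [IsProbabilityMeasure P]
    (hPμ : P ≪ Measure.pi μ) (hμP : Measure.pi μ ≪ P) :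
    ∃ p : (∀ j, Ω j) → ℝ≥0∞, Measurable p ∧ (∀ x, p x ≠ 0) ∧ P = (Measure.pi μ).withDensity p := by
  set r := P.rnDeriv (Measure.pi μ) with hr
  have hrm : Measurable r := Measure.measurable_rnDeriv _ _
  refine ⟨fun x => if r x = 0 then 1 else r x,
    Measurable.ite (hrm (measurableSet_singleton 0)) measurable_const hrm, fun x => ?_, ?_⟩
  · dsimp only; split_ifs with h <;> simp [h]
  · rw [← Measure.withDensity_rnDeriv_eq P _ hPμ]
    refine withDensity_congr_ae ?_
    filter_upwards [hμP (Measure.rnDeriv_pos hPμ)] with x hx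
    have : r x ≠ 0 := hx.ne'
    simp [this, ← hr]

end Densities

section DensityKernels

open Function

variable {V : Type*} [Fintype V] [DecidableEq V] {Ω : V → Type*} [∀ j, MeasurableSpace (Ω j)]

/-- The kernel which draws the variables in `B`, given those in `A`, with density `d` with respect to
the product of the `ν j`. The point `x₀` serves to evaluate `d`, which is meant to depend on the
variables in `A ∪ B` only. -/
noncomputable def densityKernel (ν : ∀ j, Measure (Ω j)) [∀ j, SigmaFinite (ν j)]
    (d : (∀ j, Ω j) → ℝ≥0∞) (x₀ : ∀ j, Ω j) (A B : Finset V) : Kernel (Vals Ω A) (Vals Ω B) :=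
  (Kernel.const _ (Measure.pi fun i : B => ν i)).withDensity
    fun a y => d (updateFinset (updateFinset x₀ A a) B y)

variable {ν : ∀ j, Measure (Ω j)} [∀ j, SigmaFinite (ν j)] {d : (∀ j, Ω j) → ℝ≥0∞} {x₀ : ∀ j, Ω j}
  {A B : Finset V}

omit [Fintype V] in
lemma densityKernel_apply' (hd : Measurable d) (a : Vals Ω A) :
    densityKernel ν d x₀ A B a = (Measure.pi fun i : B => ν i).withDensity
      fun y => d (updateFinset (updateFinset x₀ A a) B y) := by
  rw [densityKernel, Kernel.withDensity_apply, Kernel.const_apply]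
  refine hd.comp ?_
  exact measurable_updateFinset'.comp
    ((measurable_updateFinset.comp measurable_fst).prodMk measurable_snd)

omit [Fintype V] in
lemma densityKernel_apply (hd : Measurable d) (hdAB : DependsOn d ((A ∪ B : Finset V) : Set V))
    (x : ∀ j, Ω j) :
    densityKernel ν d x₀ A B (A.restrict x) =
      (Measure.pi fun i : B => ν i).withDensity fun y => d (updateFinset x B y) := by
  rw [densityKernel_apply' hd]
  congr 1
  ext y
  refine hdAB fun i hi => ?_
  have : i ∈ A ∨ i ∈ B := by simpa using hi
  by_cases hB : i ∈ B
  · simp [updateFinset_def, hB]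
  · simp [updateFinset_def, hB, this.resolve_right hB]

omit [Fintype V] in
lemma isMarkovKernel_densityKernel (hd : Measurable d) (h1 : ∀ x, (∫⋯∫⁻_B, d ∂ν) x = 1) :
    IsMarkovKernel (densityKernel ν d x₀ A B) :=
  ⟨fun a => ⟨by
    rw [densityKernel_apply' hd, withDensity_apply _ .univ, Measure.restrict_univ]
    exact h1 _⟩⟩

omit [Fintype V] in
lemma lintegral_densityKernel (hd : Measurable d)
    (hdAB : DependsOn d ((A ∪ B : Finset V) : Set V)) {F : (∀ j, Ω j) → ℝ≥0∞} (hF : Measurable F)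
    (x : ∀ j, Ω j) :
    ∫⁻ y, F (updateFinset x B y) ∂(densityKernel ν d x₀ A B (A.restrict x)) =
      (∫⋯∫⁻_B, (fun x => d x * F x) ∂ν) x := by
  rw [densityKernel_apply hd hdAB, lintegral_withDensity_eq_lintegral_mul _
    (hd.updateFinset_right _ _) (hF.updateFinset_right _ _)]
  rfl

/-- For a law with a positive density, every regular conditional law of `X_B` given `X_A` has the
conditional density as its density. -/
lemma condLaw_ae_eq_densityKernel {μ : ∀ j, Measure (Ω j)} [∀ j, SigmaFinite (μ j)]
    [∀ j, StandardBorelSpace (Ω j)] {p : (∀ j, Ω j) → ℝ≥0∞} (hp : Measurable p)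
    (hp0 : ∀ x, p x ≠ 0) (hp1 : ∫⁻ x, p x ∂(Measure.pi μ) = 1) (hAB : Disjoint A B)
    (κ : Kernel (Vals Ω A) (Vals Ω B)) [IsMarkovKernel κ]
    (h : ((Measure.pi μ).withDensity p).map (fun x => (A.restrict x, B.restrict x)) =
      ((Measure.pi μ).withDensity p).map A.restrict ⊗ₘ κ) (x₀ : ∀ j, Ω j) :
    ∀ᵐ x ∂(Measure.pi μ),
      κ (A.restrict x) = densityKernel μ (condInt μ p B A) x₀ A B (A.restrict x) := by
  set P := (Measure.pi μ).withDensity p with hP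
  have hμ : Measure.pi μ ≠ 0 := fun h => by simp [h] at hp1
  have : IsProbabilityMeasure P := ⟨by rw [hP, withDensity_apply _ .univ, Measure.restrict_univ, hp1]⟩
  have hμP : Measure.pi μ ≪ P := withDensity_absolutelyContinuous' hp.aemeasurable (by simp [hp0])
  have hc := measurable_condInt (μ := μ) (A := A) (B := B) hp
  have hcd := dependsOn_condInt (μ := μ) (A := A) (B := B) (p := p)
  have hM : IsMarkovKernel (densityKernel μ (condInt μ p B A) x₀ A B) :=
    isMarkovKernel_densityKernel hc (lmarginal_condInt hp hp0 hp1 hAB)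
  have hrA : Measurable (A.restrict : (∀ j, Ω j) → Vals Ω A) := Finset.measurable_restrict _
  have hrB : Measurable (B.restrict : (∀ j, Ω j) → Vals Ω B) := Finset.measurable_restrict _
  have : IsProbabilityMeasure (P.map A.restrict) := Measure.isProbabilityMeasure_map hrA.aemeasurable
  have key : P.map A.restrict ⊗ₘ densityKernel μ (condInt μ p B A) x₀ A B =
      P.map A.restrict ⊗ₘ κ := by
    rw [← h]
    refine Measure.ext_of_lintegral _ fun f hf => ?_
    have hF : Measurable fun x => f (A.restrict x, B.restrict x) := hf.comp (hrA.prodMk hrB)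
    have hFd : DependsOn (fun x => f (A.restrict x, B.restrict x)) ((A ∪ B : Finset V) : Set V) :=
      fun x y hxy => by
        have h1 : A.restrict x = A.restrict y := funext fun i => hxy i (by simp)
        have h2 : B.restrict x = B.restrict y := funext fun i => hxy i (by simp)
        simp only [h1, h2]
    have hin : ∀ x, ∫⁻ y, f (A.restrict x, y)
          ∂(densityKernel μ (condInt μ p B A) x₀ A B (A.restrict x)) =
        (∫⋯∫⁻_B, (fun x => condInt μ p B A x * f (A.restrict x, B.restrict x)) ∂μ) x := fun x => by
      rw [← lintegral_densityKernel hc hcd hF]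
      congr 1
      ext y
      rw [restrict_updateFinset]
      congr 2
      ext i
      simp [updateFinset_def, Finset.disjoint_left.1 hAB i.2]
    rw [Measure.lintegral_compProd hf, lintegral_map hf (hrA.prodMk hrB),
      lintegral_map hf.lintegral_kernel_prod_right' hrA]
    simp only [hin]
    have hcF : DependsOn (fun x => condInt μ p B A x * f (A.restrict x, B.restrict x))
      ((A ∪ B : Finset V) : Set V) := hcd.mul' hFd
    have hG : Measurable (∫⋯∫⁻_B, (fun x => condInt μ p B A x * f (A.restrict x, B.restrict x)) ∂μ) :=
      (hc.mul hF).lmarginal μ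
    -- A base point for which the density of `A` is finite at almost all values of the variables in `A`.
    have : (ae (Measure.pi μ)).NeBot := ae_neBot.2 hμ
    obtain ⟨x, hx⟩ := (ae_ae_updateFinset μ
      (margInt_ae_ne_top (A := A) hp (by rw [hp1]; exact ENNReal.one_ne_top)) A).exists
    rw [lintegral_withDensity_of_dependsOn hp hF hFd x, lintegral_withDensity_of_dependsOn hp hG
      (hcF.lmarginal μ B fun i hi hB => (by simpa [hB] using hi : i ∈ A)) x,
      lmarginal_union μ (fun x => f (A.restrict x, B.restrict x) * margInt μ p (A ∪ B) x)
        (hF.mul (measurable_margInt hp)) hAB]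
    symm
    refine lmarginal_congr_of_ae μ ?_
    filter_upwards [hx] with a ha
    set z := updateFinset x A a with hz
    have := congrFun (lmarginal_mul_left μ (dependsOn_margInt (μ := μ) (p := p) (A := A)) (s := B)
      (fun i hi h => Finset.disjoint_left.1 hAB h hi) (hc.mul hF)) z
    rw [mul_comm]
    refine Eq.trans ?_ this
    refine lmarginal_congr_of_ae μ (Filter.Eventually.of_forall fun b => ?_)
    have hb : margInt μ p A (updateFinset z B b) ≠ ∞ := by
      rwa [updateFinset_eq_self_of_dependsOn dependsOn_margInt
        (fun i hi h => Finset.disjoint_left.1 hAB h hi)]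
    rw [Pi.mul_apply, condInt_of_ne_top hb, ← mul_assoc,
      ENNReal.mul_div_cancel (margInt_ne_zero hp hp0 hμ _) hb, mul_comm]
  have := Kernel.ae_eq_of_compProd_eq key
  filter_upwards [hμP (ae_of_ae_map hrA.aemeasurable this)] with x hx using hx.symm

end DensityKernels

/-! ### Reference measures of an intervention -/

section InterventionReference

open Function

variable {V : Type*} [DecidableEq V] {Ω : V → Type*} [∀ j, MeasurableSpace (Ω j)]

/-- The reference measures under the intervention: point masses at the assigned values for the
variables in `S`, the original reference measures for the others. -/
noncomputable def doRef (μ : ∀ j, Measure (Ω j)) (S : Finset V) (xS : Vals Ω S) (j : V) :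
    Measure (Ω j) :=
  if h : j ∈ S then Measure.dirac (xS ⟨j, h⟩) else μ j

variable {μ : ∀ j, Measure (Ω j)} {S : Finset V} {xS : Vals Ω S}

lemma doRef_of_mem {j : V} (h : j ∈ S) : doRef μ S xS j = Measure.dirac (xS ⟨j, h⟩) := by
  simp [doRef, h]

lemma doRef_of_notMem {j : V} (h : j ∉ S) : doRef μ S xS j = μ j := by
  simp [doRef, h]

instance [∀ j, SigmaFinite (μ j)] (j : V) : SigmaFinite (doRef μ S xS j) := by
  by_cases h : j ∈ S
  · rw [doRef_of_mem h]; infer_instance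
  · rw [doRef_of_notMem h]; infer_instance

lemma lmarginal_doRef_of_disjoint {s : Finset V} (hs : Disjoint s S) (f : (∀ j, Ω j) → ℝ≥0∞) :
    ∫⋯∫⁻_s, f ∂(doRef μ S xS) = ∫⋯∫⁻_s, f ∂μ :=
  lmarginal_congr_measure (fun _ hj => doRef_of_notMem (Finset.disjoint_left.1 hs hj)) f

lemma lmarginal_doRef_of_subset [∀ j, SigmaFinite (μ j)] {s : Finset V} (hs : s ⊆ S)
    {f : (∀ j, Ω j) → ℝ≥0∞} (hf : Measurable f) (x : ∀ j, Ω j) :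
    (∫⋯∫⁻_s, f ∂(doRef μ S xS)) x = f (updateFinset x s fun i => xS ⟨i, hs i.2⟩) := by
  have : (Measure.pi fun i : s => doRef μ S xS i) = Measure.dirac fun i : s => xS ⟨i, hs i.2⟩ := by
    refine Measure.pi_eq fun t ht => ?_
    rw [Measure.dirac_apply' _ (MeasurableSet.univ_pi ht)]
    simp only [doRef_of_mem (hs (Subtype.prop _)), Measure.dirac_apply' _ (ht _)]
    by_cases h : ∀ i : s, xS ⟨i, hs i.2⟩ ∈ t i
    · rw [Set.indicator_of_mem (by simpa using h)]
      simp [Set.indicator_of_mem, h]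
    · rw [Set.indicator_of_notMem (by simpa using h)]
      push Not at h
      obtain ⟨i, hi⟩ := h
      exact (Finset.prod_eq_zero (Finset.mem_univ i) (Set.indicator_of_notMem hi _)).symm
  rw [lmarginal, this, lintegral_dirac' _ (hf.updateFinset_right _ _)]

/-- Integrating against the reference measures of the intervention means inserting the assigned
values and integrating the other variables against the original reference measures. -/
lemma lmarginal_doRef [∀ j, SigmaFinite (μ j)] {s t : Finset V} (hst : Disjoint t S)
    (hs : ∀ i ∈ t, i ∈ s) (hs' : ∀ i ∈ s, i ∉ t → i ∈ S) {f : (∀ j, Ω j) → ℝ≥0∞}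
    (hf : Measurable f) {x : ∀ j, Ω j} (hx : ∀ j (h : j ∈ S), x j = xS ⟨j, h⟩) :
    (∫⋯∫⁻_s, f ∂(doRef μ S xS)) x = (∫⋯∫⁻_t, f ∂μ) x := by
  have h1 : s = (s \ t) ∪ t := (Finset.sdiff_union_of_subset hs).symm
  rw [h1, lmarginal_union _ _ hf Finset.sdiff_disjoint, lmarginal_doRef_of_disjoint hst,
    lmarginal_doRef_of_subset (fun i hi => hs' i (Finset.mem_sdiff.1 hi).1 (Finset.mem_sdiff.1 hi).2)
      (hf.lmarginal μ)]
  congr 1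
  ext i
  by_cases hi : i ∈ s \ t
  · simp [updateFinset_def, hi, hx i (hs' i (Finset.mem_sdiff.1 hi).1 (Finset.mem_sdiff.1 hi).2)]
  · simp [updateFinset_def, hi]

lemma lmarginal_doRef_eq_one [∀ j, SigmaFinite (μ j)] {s t : Finset V} (hst : Disjoint t S)
    (hs : ∀ i ∈ t, i ∈ s) (hs' : ∀ i ∈ s, i ∉ t → i ∈ S) {f : (∀ j, Ω j) → ℝ≥0∞}
    (hf : Measurable f) (h1 : ∀ x, (∫⋯∫⁻_t, f ∂μ) x = 1) (x : ∀ j, Ω j) :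
    (∫⋯∫⁻_s, f ∂(doRef μ S xS)) x = 1 := by
  have h2 : s = (s \ t) ∪ t := (Finset.sdiff_union_of_subset hs).symm
  rw [h2, lmarginal_union _ _ hf Finset.sdiff_disjoint, lmarginal_doRef_of_disjoint hst,
    lmarginal_doRef_of_subset (fun i hi => hs' i (Finset.mem_sdiff.1 hi).1 (Finset.mem_sdiff.1 hi).2)
      (hf.lmarginal μ), h1]

variable [Fintype V]

omit [∀ j, MeasurableSpace (Ω j)] in
lemma glue_eq_updateFinset (x : ∀ j, Ω j) (xS : Vals Ω S) (y : Vals Ω Sᶜ) :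
    glue S xS y = updateFinset (updateFinset x S xS) Sᶜ y := by
  ext j
  by_cases h : j ∈ S <;> simp [glue, updateFinset_def, h]

lemma measurable_glue (xS : Vals Ω S) : Measurable (glue (Ω := Ω) S xS) := by
  refine measurable_pi_lambda _ fun j => ?_
  by_cases h : j ∈ S
  · simp [glue, h]
  · simpa [glue, h] using measurable_pi_apply _

lemma pi_doRef [∀ j, SigmaFinite (μ j)] :
    Measure.pi (doRef μ S xS) = (Measure.pi fun i : (Sᶜ : Finset V) => μ i).map (glue S xS) := by
  rcases isEmpty_or_nonempty (∀ j, Ω j) with he | ⟨⟨x⟩⟩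
  · ext s
    simp [Set.eq_empty_of_isEmpty s]
  refine Measure.ext_of_lintegral _ fun f hf => ?_
  rw [lintegral_map hf (measurable_glue xS), lintegral_pi_eq_lmarginal _ hf S x,
    lmarginal_doRef_of_subset subset_rfl (hf.lmarginal _),
    lmarginal_doRef_of_disjoint disjoint_compl_left, lmarginal]
  simp only [glue_eq_updateFinset x]

lemma pi_doRef_ne_zero [∀ j, SigmaFinite (μ j)] (h : Measure.pi μ ≠ 0) :
    Measure.pi (doRef μ S xS) ≠ 0 := by
  rw [pi_doRef, Ne, Measure.map_eq_zero_iff (measurable_glue xS).aemeasurable]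
  exact pi_finset_ne_zero h _

/-- Fubini for null sets: what holds almost surely under the original reference measure holds almost
surely under that of the intervention, for almost all assigned values. -/
lemma ae_ae_pi_doRef [∀ j, SigmaFinite (μ j)] {φ : (∀ j, Ω j) → Prop}
    (h : ∀ᵐ x ∂(Measure.pi μ), φ x) (S : Finset V) :
    ∀ᵐ xS ∂(Measure.pi fun i : S => μ i), ∀ᵐ x ∂(Measure.pi (doRef μ S xS)), φ x := by
  rcases isEmpty_or_nonempty (∀ j, Ω j) with he | ⟨⟨x₀⟩⟩
  · exact Filter.Eventually.of_forall fun xS => Filter.Eventually.of_forall fun x => he.elim x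
  obtain ⟨N, hN, hNm, hN0⟩ := exists_measurable_superset_of_null (ae_iff.1 h)
  have hNi : Measurable (N.indicator (1 : (∀ j, Ω j) → ℝ≥0∞)) := measurable_one.indicator hNm
  have h0 : ∫⁻ x, N.indicator 1 x ∂(Measure.pi μ) = 0 := by rw [lintegral_indicator_one hNm, hN0]
  rw [lintegral_pi_eq_lmarginal μ hNi S x₀, lmarginal,
    lintegral_eq_zero_iff ((hNi.lmarginal μ).updateFinset_right _ _)] at h0
  filter_upwards [h0] with xS hxS
  have : (Measure.pi (doRef μ S xS)) N = 0 := by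
    rw [← lintegral_indicator_one hNm, pi_doRef, lintegral_map hNi (measurable_glue xS)]
    simp only [glue_eq_updateFinset x₀]
    exact hxS
  exact ae_iff.2 (measure_mono_null hN this)

lemma ae_pi_doRef_eq [∀ j, SigmaFinite (μ j)] [∀ j, MeasurableSingletonClass (Ω j)] :
    ∀ᵐ x ∂(Measure.pi (doRef μ S xS)), ∀ j (h : j ∈ S), x j = xS ⟨j, h⟩ := by
  rw [ae_all_iff]
  intro j
  by_cases h : j ∈ S
  · have h1 : ∀ᵐ t ∂(doRef μ S xS j), t = xS ⟨j, h⟩ := by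
      rw [doRef_of_mem h, ae_dirac_eq]; rfl
    filter_upwards [Measure.tendsto_eval_ae_ae h1] with x hx _ using hx
  · exact Filter.Eventually.of_forall fun x h' => (h h').elim

end InterventionReference

/-! ### Chain graphs and ancestral sets -/

namespace ChainGraph

variable {V : Type*} (G : ChainGraph V)

/-- A set of vertices which contains, with each vertex, everything that leads to it. -/
def IsAncestral (A : Finset V) : Prop := ∀ u v, G.Leads u v → v ∈ A → u ∈ A

variable {G}

lemma leads_refl (u : V) : G.Leads u u := Relation.ReflTransGen.refl

lemma Leads.trans {u v w : V} (h : G.Leads u v) (h' : G.Leads v w) : G.Leads u w :=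
  Relation.ReflTransGen.trans h h'

lemma leads_of_reachable {u v : V} (h : G.line.Reachable u v) : G.Leads u v := by
  obtain ⟨w⟩ := h
  induction w with
  | nil => exact leads_refl _
  | cons h _ ih => exact Relation.ReflTransGen.head (Or.inl h) ih

lemma leads_of_arrow {u v : V} (h : G.arrow u v) : G.Leads u v :=
  Relation.ReflTransGen.single (Or.inr h)

variable [Fintype V] [DecidableEq V]

lemma mem_component {v w : V} : w ∈ G.component v ↔ G.line.Reachable v w := by
  simp [component]

lemma self_mem_component (v : V) : v ∈ G.component v := mem_component.2 (SimpleGraph.Reachable.refl v)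

omit [DecidableEq V] in
lemma mem_pa {τ : Finset V} {u : V} : u ∈ G.pa τ ↔ ∃ v ∈ τ, G.arrow u v := by simp [pa]

omit [DecidableEq V] in
lemma mem_nonDesc {τ : Finset V} {v : V} : v ∈ G.nonDesc τ ↔ ∀ u ∈ τ, ¬ G.Leads u v := by
  simp [nonDesc]

lemma mem_components {τ : Finset V} : τ ∈ G.components ↔ ∃ v, G.component v = τ := by
  simp [components]

lemma reachable_of_mem {τ : Finset V} (hτ : τ ∈ G.components) {u v : V} (hu : u ∈ τ) (hv : v ∈ τ) :
    G.line.Reachable u v := by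
  obtain ⟨w, rfl⟩ := mem_components.1 hτ
  exact (mem_component.1 hu).symm.trans (mem_component.1 hv)

lemma mem_of_reachable {τ : Finset V} (hτ : τ ∈ G.components) {u v : V} (hu : u ∈ τ)
    (h : G.line.Reachable u v) : v ∈ τ := by
  obtain ⟨w, rfl⟩ := mem_components.1 hτ
  exact mem_component.2 ((mem_component.1 hu).trans h)

lemma nonempty_of_mem_components {τ : Finset V} (hτ : τ ∈ G.components) : τ.Nonempty := by
  obtain ⟨w, rfl⟩ := mem_components.1 hτ
  exact ⟨w, self_mem_component w⟩

lemma eq_of_mem_components {τ σ : Finset V} (hτ : τ ∈ G.components) (hσ : σ ∈ G.components) {v : V}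
    (h : v ∈ τ) (h' : v ∈ σ) : τ = σ := by
  ext w
  exact ⟨fun hw => mem_of_reachable hσ h' (reachable_of_mem hτ h hw),
    fun hw => mem_of_reachable hτ h (reachable_of_mem hσ h' hw)⟩

lemma subset_or_disjoint_of_isAncestral {τ A : Finset V} (hτ : τ ∈ G.components)
    (hA : G.IsAncestral A) : τ ⊆ A ∨ Disjoint τ A := by
  by_cases h : Disjoint τ A
  · exact Or.inr h
  · obtain ⟨v, hv, hvA⟩ := Finset.not_disjoint_iff.1 h
    exact Or.inl fun u hu => hA u v (leads_of_reachable (reachable_of_mem hτ hu hv)) hvA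

lemma disjoint_pa {τ : Finset V} (hτ : τ ∈ G.components) : Disjoint (G.pa τ) τ := by
  refine Finset.disjoint_left.2 fun u hu huτ => ?_
  obtain ⟨v, hv, huv⟩ := mem_pa.1 hu
  exact G.acyclic u v huv (leads_of_reachable (reachable_of_mem hτ hv huτ))

omit [DecidableEq V] in
lemma disjoint_nonDesc (τ : Finset V) : Disjoint (G.nonDesc τ) τ :=
  Finset.disjoint_left.2 fun u hu huτ => mem_nonDesc.1 hu u huτ (leads_refl u)

lemma pa_subset_nonDesc {τ : Finset V} (hτ : τ ∈ G.components) : G.pa τ ⊆ G.nonDesc τ := by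
  intro u hu
  obtain ⟨v, hv, huv⟩ := mem_pa.1 hu
  refine mem_nonDesc.2 fun w hw hwu => G.acyclic u v huv ?_
  exact (leads_of_reachable (reachable_of_mem hτ hv hw)).trans hwu

omit [DecidableEq V] in
lemma isAncestral_nonDesc (τ : Finset V) : G.IsAncestral (G.nonDesc τ) := fun _ _ h hv =>
  mem_nonDesc.2 fun u hu h' => mem_nonDesc.1 hv u hu (h'.trans h)

lemma isAncestral_union {τ A : Finset V} (hτ : τ ∈ G.components) (hA : G.IsAncestral A)
    (hpa : G.pa τ ⊆ A) : G.IsAncestral (A ∪ τ) := by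
  intro u v h
  induction h using Relation.ReflTransGen.head_induction_on with
  | refl => exact id
  | @head a b hab _ ih =>
    intro hv
    rcases Finset.mem_union.1 (ih hv) with hb | hb
    · exact Finset.mem_union_left _ (hA a b (Relation.ReflTransGen.single hab) hb)
    · rcases hab with hab | hab
      · exact Finset.mem_union_right _ (mem_of_reachable hτ hb hab.symm.reachable)
      · exact Finset.mem_union_left _ (hpa (mem_pa.2 ⟨b, hb, hab⟩))

omit [DecidableEq V] in
lemma subset_nonDesc_of_isAncestral {τ A : Finset V} (hA : G.IsAncestral A) (h : Disjoint τ A) :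
    A ⊆ G.nonDesc τ := fun _ hv =>
  mem_nonDesc.2 fun _ hu huv => Finset.disjoint_left.1 h hu (hA _ _ huv hv)

/-- A set difference of ancestral sets contains a terminal chain component: one whose removal leaves
an ancestral set. -/
lemma exists_terminal_component {A B : Finset V} (hA : G.IsAncestral A) (hB : G.IsAncestral B)
    (hne : (B \ A).Nonempty) :
    ∃ τ ∈ G.components, τ ⊆ B ∧ Disjoint τ A ∧ G.IsAncestral (B \ τ) ∧ G.pa τ ⊆ B \ τ := by
  classical
  -- A vertex with as few descendants as possible lies in a terminal component.
  obtain ⟨v, hv, hmin⟩ := Finset.exists_min_image (B \ A)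
    (fun v => (Finset.univ.filter fun w => G.Leads v w).card) hne
  obtain ⟨hvB, hvA⟩ := Finset.mem_sdiff.1 hv
  have hτ : G.component v ∈ G.components := mem_components.2 ⟨v, rfl⟩
  have hτB : G.component v ⊆ B := (subset_or_disjoint_of_isAncestral hτ hB).resolve_right fun h =>
    Finset.disjoint_left.1 h (self_mem_component v) hvB
  have hτA : Disjoint (G.component v) A := (subset_or_disjoint_of_isAncestral hτ hA).resolve_left
    fun h => hvA (h (self_mem_component v))
  have hterm : ∀ a b, a ∈ G.component v → G.arrow a b → b ∉ B := by
    intro a b ha hab hb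
    have hbA : b ∉ A := fun h => Finset.disjoint_left.1 hτA ha (hA a b (leads_of_arrow hab) h)
    have hva : G.Leads v a := leads_of_reachable (mem_component.1 ha)
    refine absurd (hmin b (Finset.mem_sdiff.2 ⟨hb, hbA⟩)) (not_le.2 (Finset.card_lt_card ?_))
    refine Finset.ssubset_iff_of_subset (fun w hw => ?_) |>.2 ⟨v, ?_, ?_⟩
    · simp only [Finset.mem_filter, Finset.mem_univ, true_and] at hw ⊢
      exact hva.trans ((leads_of_arrow hab).trans hw)
    · simpa using leads_refl v
    · simpa using fun h : G.Leads b v => G.acyclic a b hab (h.trans hva)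
  have hBτ : G.IsAncestral (B \ G.component v) := by
    intro a b h
    induction h using Relation.ReflTransGen.head_induction_on with
    | refl => exact id
    | @head a c hac _ ih =>
      intro hb
      obtain ⟨hcB, hcτ⟩ := Finset.mem_sdiff.1 (ih hb)
      refine Finset.mem_sdiff.2 ⟨hB a c (Relation.ReflTransGen.single hac) hcB, fun ha => ?_⟩
      rcases hac with hac | hac
      · exact hcτ (mem_of_reachable hτ ha hac.reachable)
      · exact hterm a c ha hac hcB
  refine ⟨_, hτ, hτB, hτA, hBτ, fun u hu => Finset.mem_sdiff.2 ⟨?_, ?_⟩⟩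
  · obtain ⟨w, hw, huw⟩ := mem_pa.1 hu
    exact hB u w (leads_of_arrow huw) (hτB hw)
  · exact Finset.disjoint_left.1 (disjoint_pa hτ) hu

end ChainGraph

section Factorization

open Function

variable {V : Type*} [Fintype V] [DecidableEq V] {Ω : V → Type*} [∀ j, MeasurableSpace (Ω j)]

/-- The product of the factors `d τ` over the chain components contained in `A`. -/
noncomputable def blockProd (G : ChainGraph V) (d : Finset V → (∀ j, Ω j) → ℝ≥0∞) (A : Finset V)
    (x : ∀ j, Ω j) : ℝ≥0∞ :=
  ∏ τ ∈ G.components with τ ⊆ A, d τ x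

variable {G : ChainGraph V} {ν : ∀ j, Measure (Ω j)} [∀ j, SigmaFinite (ν j)]
  {d : Finset V → (∀ j, Ω j) → ℝ≥0∞}

lemma measurable_blockProd (hd : ∀ τ, Measurable (d τ)) (A : Finset V) :
    Measurable (blockProd G d A) :=
  Finset.measurable_fun_prod _ fun τ _ => hd τ

omit [∀ j, MeasurableSpace (Ω j)] in
lemma blockProd_union {τ A : Finset V} (hτ : τ ∈ G.components) (hA : Disjoint A τ) :
    blockProd G d (A ∪ τ) = fun x => blockProd G d A x * d τ x := by
  ext x
  have hne := ChainGraph.nonempty_of_mem_components hτ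
  have : {σ ∈ G.components | σ ⊆ A ∪ τ} = insert τ {σ ∈ G.components | σ ⊆ A} := by
    ext σ
    simp only [Finset.mem_filter, Finset.mem_insert]
    constructor
    · rintro ⟨h1, h2⟩
      by_cases hσ : σ = τ
      · exact Or.inl hσ
      · refine Or.inr ⟨h1, fun v hv => (Finset.mem_union.1 (h2 hv)).resolve_right fun h => ?_⟩
        exact hσ (ChainGraph.eq_of_mem_components h1 hτ hv h)
    · rintro (rfl | ⟨h1, h2⟩)
      · exact ⟨hτ, Finset.subset_union_right⟩
      · exact ⟨h1, h2.trans Finset.subset_union_left⟩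
  rw [blockProd, this, Finset.prod_insert, mul_comm, blockProd]
  intro h
  obtain ⟨v, hv⟩ := hne
  exact Finset.disjoint_left.1 hA ((Finset.mem_filter.1 h).2 hv) hv

omit [∀ j, MeasurableSpace (Ω j)] in
lemma dependsOn_blockProd {A : Finset V} (hA : G.IsAncestral A)
    (hdep : ∀ τ ∈ G.components, DependsOn (d τ) ((G.pa τ ∪ τ : Finset V) : Set V)) :
    DependsOn (blockProd G d A) (A : Set V) := by
  intro x y h
  refine Finset.prod_congr rfl fun τ hτ => ?_
  obtain ⟨hτ, hτA⟩ := Finset.mem_filter.1 hτ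
  refine hdep τ hτ fun i hi => h i ?_
  rcases Finset.mem_union.1 (Finset.mem_coe.1 hi) with hi | hi
  · obtain ⟨v, hv, hiv⟩ := ChainGraph.mem_pa.1 hi
    exact hA i v (ChainGraph.leads_of_arrow hiv) (hτA hv)
  · exact hτA hi

/-- Integrating out everything outside an ancestral set removes the factors of the components outside
of it: terminal components can be integrated out one after the other. -/
lemma lmarginal_blockProd (hd : ∀ τ, Measurable (d τ))
    (hdep : ∀ τ ∈ G.components, DependsOn (d τ) ((G.pa τ ∪ τ : Finset V) : Set V))
    (h1 : ∀ τ ∈ G.components, ∀ x, (∫⋯∫⁻_τ, d τ ∂ν) x = 1) {A : Finset V}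
    (hA : G.IsAncestral A) (B : Finset V) (hAB : A ⊆ B) (hB : G.IsAncestral B) :
    ∫⋯∫⁻_(B \ A), blockProd G d B ∂ν = blockProd G d A := by
  induction B using Finset.strongInduction with
  | H B ih =>
    rcases (B \ A).eq_empty_or_nonempty with he | hne
    · rw [he, lmarginal_empty, subset_antisymm hAB (Finset.sdiff_eq_empty_iff_subset.1 he)]
    obtain ⟨τ, hτ, hτB, hτA, hBτ, hpa⟩ := ChainGraph.exists_terminal_component hA hB hne
    have hss : B \ τ ⊂ B := Finset.sdiff_ssubset hτB (ChainGraph.nonempty_of_mem_components hτ)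
    have hAB' : A ⊆ B \ τ := fun v hv =>
      Finset.mem_sdiff.2 ⟨hAB hv, fun h => Finset.disjoint_left.1 hτA h hv⟩
    have e1 : B \ A = ((B \ τ) \ A) ∪ τ := by
      ext v
      have h1 : v ∈ τ → v ∈ B := fun h => hτB h
      have h2 : v ∈ τ → v ∉ A := fun h => Finset.disjoint_left.1 hτA h
      simp only [Finset.mem_sdiff, Finset.mem_union]
      tauto
    have e2 : B = (B \ τ) ∪ τ := (Finset.sdiff_union_of_subset hτB).symm
    have e3 : blockProd G d B = fun x => blockProd G d (B \ τ) x * d τ x := by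
      conv_lhs => rw [e2]
      exact blockProd_union hτ Finset.sdiff_disjoint
    rw [e1, lmarginal_union ν _ (measurable_blockProd hd B), e3,
      lmarginal_mul_left ν (dependsOn_blockProd hBτ hdep) (by simp +contextual) (hd τ)]
    · simp only [h1 τ hτ, mul_one]
      exact ih _ hss hAB' hBτ
    · exact Finset.disjoint_left.2 fun v hv h => (Finset.mem_sdiff.1 (Finset.mem_sdiff.1 hv).1).2 h

omit [DecidableEq V] in
lemma isAncestral_univ : G.IsAncestral Finset.univ := fun _ _ _ _ => Finset.mem_univ _

omit [Fintype V] [DecidableEq V] in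
lemma isAncestral_empty : G.IsAncestral ∅ := fun _ _ _ h => (Finset.notMem_empty _ h).elim

/-- Expectations of functions of an ancestral set of variables under the law whose density is the
product of all factors. -/
lemma lintegral_blockProd (hd : ∀ τ, Measurable (d τ))
    (hdep : ∀ τ ∈ G.components, DependsOn (d τ) ((G.pa τ ∪ τ : Finset V) : Set V))
    (h1 : ∀ τ ∈ G.components, ∀ x, (∫⋯∫⁻_τ, d τ ∂ν) x = 1) {A : Finset V}
    (hA : G.IsAncestral A) {F : (∀ j, Ω j) → ℝ≥0∞} (hF : Measurable F)
    (hFA : DependsOn F (A : Set V)) (x : ∀ j, Ω j) :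
    ∫⁻ x, F x ∂((Measure.pi ν).withDensity (blockProd G d Finset.univ)) =
      (∫⋯∫⁻_A, (fun x => F x * blockProd G d A x) ∂ν) x := by
  have hD := measurable_blockProd (G := G) hd Finset.univ
  rw [lintegral_withDensity_eq_lintegral_mul _ hD hF, lintegral_pi_eq_lmarginal ν (hD.mul hF) A x]
  congr 1
  have : blockProd G d Finset.univ * F = fun x => F x * blockProd G d Finset.univ x := by
    ext; simp [mul_comm]
  rw [this, lmarginal_mul_left ν hFA (by simp) hD]
  have := lmarginal_blockProd hd hdep h1 hA Finset.univ (Finset.subset_univ _) isAncestral_univ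
  rw [← Finset.compl_eq_univ_sdiff] at this
  rw [this]

lemma isProbabilityMeasure_blockProd (hd : ∀ τ, Measurable (d τ))
    (hdep : ∀ τ ∈ G.components, DependsOn (d τ) ((G.pa τ ∪ τ : Finset V) : Set V))
    (h1 : ∀ τ ∈ G.components, ∀ x, (∫⋯∫⁻_τ, d τ ∂ν) x = 1) (x₀ : ∀ j, Ω j) :
    IsProbabilityMeasure ((Measure.pi ν).withDensity (blockProd G d Finset.univ)) := by
  refine ⟨?_⟩
  rw [← lintegral_one, lintegral_blockProd hd hdep h1 isAncestral_empty measurable_const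
    (fun _ _ _ => rfl) x₀, lmarginal_empty, one_mul, blockProd, Finset.prod_eq_one]
  intro τ hτ
  obtain ⟨hτ, h⟩ := Finset.mem_filter.1 hτ
  exact absurd (Finset.subset_empty.1 h) (ChainGraph.nonempty_of_mem_components hτ).ne_empty

/-- Under the law whose density is the product of all factors, every component is drawn from the
kernel with density `d τ`, given its parents. -/
lemma drawnFrom_blockProd (hd : ∀ τ, Measurable (d τ))
    (hdep : ∀ τ ∈ G.components, DependsOn (d τ) ((G.pa τ ∪ τ : Finset V) : Set V))
    (h1 : ∀ τ ∈ G.components, ∀ x, (∫⋯∫⁻_τ, d τ ∂ν) x = 1) (x₀ : ∀ j, Ω j)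
    {τ : Finset V} (hτ : τ ∈ G.components) :
    DrawnFrom G ((Measure.pi ν).withDensity (blockProd G d Finset.univ)) τ
      (densityKernel ν (d τ) x₀ (G.pa τ) τ) := by
  have := isProbabilityMeasure_blockProd hd hdep h1 x₀
  have hM : IsMarkovKernel (densityKernel ν (d τ) x₀ (G.pa τ) τ) :=
    isMarkovKernel_densityKernel (hd τ) (h1 τ hτ)
  have hr : ∀ A : Finset V, Measurable (A.restrict : (∀ j, Ω j) → Vals Ω A) :=
    fun A => Finset.measurable_restrict _
  refine Measure.ext_of_lintegral _ fun f hf => ?_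
  have hF : Measurable fun x : ∀ j, Ω j => f ((G.nonDesc τ).restrict x, τ.restrict x) :=
    hf.comp ((hr _).prodMk (hr _))
  have hFd : DependsOn (fun x : ∀ j, Ω j => f ((G.nonDesc τ).restrict x, τ.restrict x))
      ((G.nonDesc τ ∪ τ : Finset V) : Set V) := fun x y hxy => by
    have h1 : (G.nonDesc τ).restrict x = (G.nonDesc τ).restrict y := funext fun i => hxy i (by simp)
    have h2 : τ.restrict x = τ.restrict y := funext fun i => hxy i (by simp)
    simp only [h1, h2]
  have hmap : Measurable fun p : (∀ j, Ω j) × Vals Ω τ => ((G.nonDesc τ).restrict p.1, p.2) :=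
    ((hr _).comp measurable_fst).prodMk measurable_snd
  have hanc := ChainGraph.isAncestral_nonDesc (G := G) τ
  have hpa := ChainGraph.pa_subset_nonDesc hτ
  have hdis := ChainGraph.disjoint_nonDesc (G := G) τ
  have hin : ∀ x, ∫⁻ y, f ((G.nonDesc τ).restrict x, y)
        ∂(densityKernel ν (d τ) x₀ (G.pa τ) τ ((G.pa τ).restrict x)) =
      (∫⋯∫⁻_τ, (fun x => d τ x * f ((G.nonDesc τ).restrict x, τ.restrict x)) ∂ν) x := fun x => by
    rw [← lintegral_densityKernel (hd τ) (hdep τ hτ) hF]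
    congr 1
    ext y
    rw [restrict_updateFinset]
    congr 2
    ext i
    simp [updateFinset_def, Finset.disjoint_left.1 hdis i.2]
  rw [lintegral_map hf ((hr _).prodMk (hr _)), lintegral_map hf hmap,
    Measure.lintegral_compProd
      (f := fun p : (∀ j, Ω j) × Vals Ω τ => f ((G.nonDesc τ).restrict p.1, p.2)) (hf.comp hmap)]
  simp only [Kernel.comap_apply, hin]
  have hdFm : Measurable fun x => d τ x * f ((G.nonDesc τ).restrict x, τ.restrict x) :=
    (hd τ).mul hF
  have hdF : DependsOn (fun x => d τ x * f ((G.nonDesc τ).restrict x, τ.restrict x))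
      ((G.nonDesc τ ∪ τ : Finset V) : Set V) :=
    ((hdep τ hτ).mono (by
      intro i hi
      simp only [Finset.coe_union, Set.mem_union, Finset.mem_coe] at hi ⊢
      exact hi.imp_left fun h => hpa h)).mul' hFd
  rw [lintegral_blockProd hd hdep h1 (ChainGraph.isAncestral_union hτ hanc hpa) hF hFd x₀,
    lintegral_blockProd hd hdep h1 hanc (hdFm.lmarginal ν)
      (hdF.lmarginal ν τ fun i hi hB => (by simpa [hB] using hi : i ∈ G.nonDesc τ)) x₀,
    lmarginal_union ν (fun x => f ((G.nonDesc τ).restrict x, τ.restrict x) *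
      blockProd G d (G.nonDesc τ ∪ τ) x) (hF.mul (measurable_blockProd hd _)) hdis, blockProd_union hτ hdis]
  congr 1
  ext x
  have := congrFun (lmarginal_mul_left ν (dependsOn_blockProd hanc hdep) (s := τ)
    (fun i hi h => Finset.disjoint_left.1 hdis h hi) ((hd τ).mul hF)) x
  rw [mul_comm]
  refine Eq.trans ?_ this
  congr 1
  ext z
  simp only [Pi.mul_apply]
  ring

end Factorization

/-! ### Uniqueness of equilibria -/

section InvariantMeasures

variable {E : Type*} [MeasurableSpace E] {ι : Type*} [Fintype ι]

/-- The positive part of the difference of two invariant measures of a mixture of Markov kernels is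
invariant: it is dominated by its image, which has the same mass. -/
lemma sub_invariant {K : ι → Kernel E E} [∀ i, IsMarkovKernel (K i)] {c : ι → ℝ≥0}
    (hc : ∑ i, c i = 1) {α β : Measure E} [IsFiniteMeasure α] [IsFiniteMeasure β]
    (hα : ∑ i, c i • α.bind (K i) = α) (hβ : ∑ i, c i • β.bind (K i) = β) :
    ∑ i, c i • (α - β).bind (K i) = α - β := by
  have hap : ∀ (m : Measure E) (s : Set E), MeasurableSet s →
      (∑ i, c i • m.bind (K i)) s = ∑ i, c i * ∫⁻ x, K i x s ∂m := fun m s hs => by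
    rw [Measure.finsetSum_apply]
    refine Finset.sum_congr rfl fun i _ => ?_
    rw [Measure.smul_apply, Measure.bind_apply hs (K i).aemeasurable]; rfl
  have hsub : α ≤ (α - β) + β := Measure.sub_le_iff_le_add.1 le_rfl
  have hle : α ≤ (∑ i, c i • (α - β).bind (K i)) + β := by
    refine Measure.le_iff.2 fun s hs => ?_
    conv_lhs => rw [← hα, hap _ s hs]
    rw [Measure.add_apply]
    conv_rhs => rw [← hβ, hap _ s hs, hap _ s hs, ← Finset.sum_add_distrib]
    refine Finset.sum_le_sum fun i _ => ?_
    rw [hβ, ← mul_add, ← lintegral_add_measure]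
    gcongr
  refine (Measure.eq_of_le_of_measure_univ_eq (Measure.sub_le_of_le_add hle) ?_).symm
  rw [hap _ _ .univ]
  simp only [measure_univ, lintegral_one]
  rw [← Finset.sum_mul, ← ENNReal.ofNNReal_finsetSum, hc, ENNReal.coe_one, one_mul]

/-- If every nonzero invariant measure dominates one and the same nonzero measure, then there is at
most one invariant probability measure: the two parts of a difference of invariant measures are
invariant and mutually singular. -/
lemma invariant_unique {K : ι → Kernel E E} [∀ i, IsMarkovKernel (K i)] {c : ι → ℝ≥0}
    (hc : ∑ i, c i = 1) {l : Measure E} (hl : l ≠ 0)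
    (hdom : ∀ α : Measure E, IsFiniteMeasure α → α ≠ 0 → ∑ i, c i • α.bind (K i) = α → l ≪ α)
    {α β : Measure E} [IsProbabilityMeasure α] [IsProbabilityMeasure β]
    (hα : ∑ i, c i • α.bind (K i) = α) (hβ : ∑ i, c i • β.bind (K i) = β) : α = β := by
  by_cases h1 : α - β = 0
  · refine Measure.eq_of_le_of_measure_univ_eq ?_ (by simp)
    simpa [h1] using (Measure.sub_le_iff_le_add (μ := α) (ν := β) (ξ := α - β)).1 le_rfl
  by_cases h2 : β - α = 0
  · refine (Measure.eq_of_le_of_measure_univ_eq ?_ (by simp)).symm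
    simpa [h2] using (Measure.sub_le_iff_le_add (μ := β) (ν := α) (ξ := β - α)).1 le_rfl
  have hs := Measure.mutually_singular_measure_sub (μ := α) (ν := β)
  exact absurd ((Measure.MutuallySingular.self_iff l).1
    (hs.mono_ac (hdom _ inferInstance h1 (sub_invariant hc hα hβ))
      (hdom _ inferInstance h2 (sub_invariant hc hβ hα)))) hl

end InvariantMeasures

section Equilibria

open Function

variable {V : Type*} [Fintype V] [DecidableEq V] {Ω : V → Type*} [∀ j, MeasurableSpace (Ω j)]
  {μ : ∀ j, Measure (Ω j)} {G : ChainGraph V} {τ : Finset V}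

omit [Fintype V] [DecidableEq V] in
lemma measurable_others (j : τ) : Measurable (others (Ω := Ω) j) :=
  measurable_pi_lambda _ fun i => measurable_pi_apply (i : τ)

/-- The update of variable `j` as a Markov kernel on the configurations of the component. -/
noncomputable def InteractionMechanism.stepKernel (m : InteractionMechanism G Ω μ τ)
    (S : Finset V) (xS : Vals Ω S) (xpa : Vals Ω (G.pa τ)) (j : τ) :
    Kernel (Vals Ω τ) (Vals Ω τ) :=
  if h : (j : V) ∈ S then Kernel.deterministic (fun y => Function.update y j (xS ⟨j, h⟩))
      measurable_update_left
  else (Kernel.id ×ₖ (m.update j).comap (fun y => (xpa, others j y))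
      (measurable_const.prodMk (measurable_others j))).map fun p => Function.update p.1 j p.2

variable (m : InteractionMechanism G Ω μ τ) (S : Finset V) (xS : Vals Ω S)
  (xpa : Vals Ω (G.pa τ))

omit [Fintype V] in
lemma measurable_update_prod (j : τ) :
    Measurable fun p : Vals Ω τ × Ω j => Function.update p.1 j p.2 := by
  refine measurable_pi_lambda _ fun i => ?_
  by_cases h : i = j
  · subst h; simpa using measurable_snd
  · simpa [h] using measurable_pi_iff.1 measurable_fst i

lemma InteractionMechanism.stepKernel_apply (j : τ) (y : Vals Ω τ) :
    m.stepKernel S xS xpa j y = m.step S xS xpa j y := by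
  by_cases h : (j : V) ∈ S
  · simp [stepKernel, step, h, Kernel.deterministic_apply]
  · rw [stepKernel, step, dif_neg h, dif_neg h, Kernel.map_apply _ (measurable_update_prod j),
      Kernel.prod_apply, Kernel.id_apply, Kernel.comap_apply, Measure.dirac_prod,
      Measure.map_map (measurable_update_prod j) measurable_prodMk_left]
    rfl

instance (j : τ) : IsMarkovKernel (m.stepKernel S xS xpa j) := by
  by_cases h : (j : V) ∈ S
  · rw [InteractionMechanism.stepKernel, dif_pos h]; infer_instance
  · rw [InteractionMechanism.stepKernel, dif_neg h]
    exact Kernel.IsMarkovKernel.map _ (measurable_update_prod j)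

lemma InteractionMechanism.coe_stepKernel (j : τ) :
    ⇑(m.stepKernel S xS xpa j) = m.step S xS xpa j :=
  funext fun y => m.stepKernel_apply S xS xpa j y

/-- A measure that dominates its image under every update dominates the product of the reference
measures: after all variables have been updated once, every set of positive reference measure is hit
with positive probability. -/
lemma InteractionMechanism.pi_doRef_absolutelyContinuous [∀ j, SigmaFinite (μ j)]
    {α : Measure (Vals Ω τ)} (h0 : α ≠ 0)
    (hα : ∀ j, α.bind (m.stepKernel S xS xpa j) ≪ α) :
    (Measure.pi fun i : τ => doRef μ S xS i) ≪ α := by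
  refine Measure.AbsolutelyContinuous.mk fun N hN hN0 => ?_
  have hf : Measurable (N.indicator (1 : Vals Ω τ → ℝ≥0∞)) := measurable_one.indicator hN
  have key : ∀ A : Finset τ, ∀ᵐ y ∂α,
      (∫⋯∫⁻_A, N.indicator 1 ∂(fun i : τ => doRef μ S xS i)) y = 0 := by
    intro A
    induction A using Finset.induction with
    | empty =>
      rw [lmarginal_empty]
      filter_upwards [measure_eq_zero_iff_ae_notMem.1 hN0] with y hy
      exact Set.indicator_of_notMem hy _
    | insert i A hi ih =>
      have hm : Measurable (∫⋯∫⁻_A, N.indicator 1 ∂(fun i : τ => doRef μ S xS i)) := hf.lmarginal _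
      have hmu : ∀ y, Measurable fun t : Ω i => (∫⋯∫⁻_A, N.indicator 1
          ∂(fun i : τ => doRef μ S xS i)) (Function.update y i t) :=
        fun y => hm.comp (measurable_update y)
      have h1 := Measure.ae_ae_of_ae_bind (m.stepKernel S xS xpa i).aemeasurable (hα i ih)
      filter_upwards [h1] with y hy
      rw [lmarginal_insert _ hf hi, lintegral_eq_zero_iff (hmu y)]
      rw [InteractionMechanism.stepKernel_apply] at hy
      -- Whether assigned or drawn, the new value of variable `i` has a law that dominates `doRef`.
      by_cases h : (i : V) ∈ S
      · rw [InteractionMechanism.step, dif_pos h] at hy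
        replace hy := (ae_dirac_iff (hm (measurableSet_singleton 0))).1 hy
        rw [doRef_of_mem h]
        refine (ae_dirac_iff ?_).2 hy
        exact hmu y (measurableSet_singleton 0)
      · rw [InteractionMechanism.step, dif_neg h] at hy
        rw [doRef_of_notMem h]
        exact m.ac_update i _ (ae_of_ae_map (measurable_update y).aemeasurable hy)
  have : (ae α).NeBot := ae_neBot.2 h0
  obtain ⟨y, hy⟩ := (key Finset.univ).exists
  rwa [lmarginal_univ, lintegral_indicator_one hN] at hy

/-- Uniqueness holds for all values of the parents and all assignments, without exceptional sets. The
rates only enter as weights of a mixture of updates. -/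
lemma InteractionMechanism.IsEquilibrium.unique [∀ j, SigmaFinite (μ j)] (hτ : τ.Nonempty)
    (hμ : Measure.pi μ ≠ 0) {α β : Measure (Vals Ω τ)} (hα : m.IsEquilibrium S xS xpa α)
    (hβ : m.IsEquilibrium S xS xpa β) : α = β := by
  have : Nonempty τ := hτ.to_subtype
  have hR : ∑ j, m.rate j ≠ 0 := by
    obtain ⟨j⟩ := this
    exact (Finset.sum_pos (fun j _ => m.rate_pos j) ⟨j, Finset.mem_univ j⟩).ne'
  have hc : ∑ j, (∑ j, m.rate j)⁻¹ * m.rate j = 1 := by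
    rw [← Finset.mul_sum, inv_mul_cancel₀ hR]
  have hinv : ∀ α : Measure (Vals Ω τ), m.IsEquilibrium S xS xpa α →
      ∑ j, ((∑ j, m.rate j)⁻¹ * m.rate j) • α.bind (m.stepKernel S xS xpa j) = α := fun α h => by
    simp only [mul_smul, coe_stepKernel]
    rw [← Finset.smul_sum, h.2, smul_smul, inv_mul_cancel₀ hR, one_smul]
  have := hα.1
  have := hβ.1
  refine invariant_unique hc (l := Measure.pi fun i : τ => doRef μ S xS i)
    (pi_finset_ne_zero (pi_doRef_ne_zero hμ) τ) ?_ (hinv α hα) (hinv β hβ)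
  intro γ _ hγ hγinv
  refine m.pi_doRef_absolutelyContinuous S xS xpa hγ fun j => ?_
  refine Measure.AbsolutelyContinuous.mk fun N hN hN0 => ?_
  rw [← hγinv, Measure.finsetSum_apply, Finset.sum_eq_zero_iff] at hN0
  have := hN0 j (Finset.mem_univ j)
  rw [Measure.smul_apply] at this
  refine (smul_eq_zero.1 this).resolve_left ?_
  exact mul_ne_zero (inv_ne_zero hR) (m.rate_pos j).ne'

end Equilibria

/-! ### Uniqueness of laws generated along a chain graph -/

section UniquenessOfLaws

open Function

variable {V : Type*} [Fintype V] [DecidableEq V] {Ω : V → Type*} [∀ j, MeasurableSpace (Ω j)]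
  {G : ChainGraph V}

omit [DecidableEq V] in
/-- A component is drawn from its kernel also jointly with any set of non-descendants that contains
its parents. -/
lemma DrawnFrom.map_restrict {Q : Measure (∀ j, Ω j)} [IsProbabilityMeasure Q] {τ A : Finset V}
    {η : Kernel (Vals Ω (G.pa τ)) (Vals Ω τ)} [IsMarkovKernel η] (h : DrawnFrom G Q τ η)
    (hA : A ⊆ G.nonDesc τ) (hpa : G.pa τ ⊆ A) :
    Q.map (fun x => (A.restrict x, τ.restrict x)) =
      Q.map A.restrict ⊗ₘ η.comap (Finset.restrict₂ hpa) (Finset.measurable_restrict₂ hpa) := by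
  have hr : ∀ A : Finset V, Measurable (A.restrict : (∀ j, Ω j) → Vals Ω A) :=
    fun A => Finset.measurable_restrict _
  have hr2 : Measurable (Finset.restrict₂ (π := Ω) hA) := Finset.measurable_restrict₂ hA
  have : IsProbabilityMeasure (Q.map A.restrict) :=
    Measure.isProbabilityMeasure_map (hr A).aemeasurable
  have hp : Measurable fun p : (∀ i : G.nonDesc τ, Ω i) × Vals Ω τ =>
      (Finset.restrict₂ (π := Ω) hA p.1, p.2) := (hr2.comp measurable_fst).prodMk measurable_snd
  have h1 := congrArg (Measure.map fun p : (∀ i : G.nonDesc τ, Ω i) × Vals Ω τ =>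
    (Finset.restrict₂ (π := Ω) hA p.1, p.2)) h
  have hnd : Measurable fun p : (∀ j, Ω j) × Vals Ω τ => ((G.nonDesc τ).restrict p.1, p.2) :=
    ((hr _).comp measurable_fst).prodMk measurable_snd
  rw [Measure.map_map hp ((hr _).prodMk (hr _)), Measure.map_map hp hnd] at h1
  refine Eq.trans h1 ?_
  refine Measure.ext_of_lintegral _ fun f hf => ?_
  have hm : Measurable fun p : (∀ j, Ω j) × Vals Ω τ => (A.restrict p.1, p.2) :=
    ((hr _).comp measurable_fst).prodMk measurable_snd
  have h2 : ((fun p : (∀ i : G.nonDesc τ, Ω i) × Vals Ω τ => (Finset.restrict₂ (π := Ω) hA p.1, p.2)) ∘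
      fun p : (∀ j, Ω j) × Vals Ω τ => ((G.nonDesc τ).restrict p.1, p.2)) =
      fun p => (A.restrict p.1, p.2) := rfl
  rw [h2, lintegral_map hf hm, Measure.lintegral_compProd
    (f := fun p : (∀ j, Ω j) × Vals Ω τ => f (A.restrict p.1, p.2)) (hf.comp hm),
    Measure.lintegral_compProd hf, lintegral_map hf.lintegral_kernel_prod_right' (hr A)]
  rfl

omit [Fintype V] in
lemma map_restrict_eq_of_map_prod {Q Q' : Measure (∀ j, Ω j)} {A B C : Finset V}
    (hC : C ⊆ A ∪ B)
    (h : Q.map (fun x => (A.restrict x, B.restrict x)) =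
      Q'.map (fun x => (A.restrict x, B.restrict x))) :
    Q.map C.restrict = Q'.map C.restrict := by
  have hr : ∀ A : Finset V, Measurable (A.restrict : (∀ j, Ω j) → Vals Ω A) :=
    fun A => Finset.measurable_restrict _
  let g : Vals Ω A × Vals Ω B → Vals Ω C := fun p i =>
    if hi : (i : V) ∈ A then p.1 ⟨i, hi⟩
    else p.2 ⟨i, (Finset.mem_union.1 (hC i.2)).resolve_left hi⟩
  have hg : Measurable g := by
    refine measurable_pi_lambda _ fun i => ?_
    by_cases hi : (i : V) ∈ A
    · simpa [g, hi] using measurable_pi_iff.1 measurable_fst _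
    · simpa [g, hi] using measurable_pi_iff.1 measurable_snd _
  have h1 := congrArg (Measure.map g) h
  rw [Measure.map_map hg ((hr A).prodMk (hr B)), Measure.map_map hg ((hr A).prodMk (hr B))] at h1
  have h2 : g ∘ (fun x : ∀ j, Ω j => (A.restrict x, B.restrict x)) = C.restrict := by
    ext x i
    by_cases hi : (i : V) ∈ A <;> simp [g, hi]
  rwa [h2] at h1

/-- Suppose that the mechanism of each component, expressed by `φ`, admits at most one conditional
law given the parents. Then a law `Q` which obeys all mechanisms equals any law `Q'` which obeys them
for almost every value of the parents with respect to the law of the parents: the marginals on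
ancestral sets agree, by adding one terminal component after the other. -/
lemma eq_of_drawnFrom {Q Q' : Measure (∀ j, Ω j)} [IsProbabilityMeasure Q] [IsProbabilityMeasure Q']
    (φ : ∀ τ, Vals Ω (G.pa τ) → Measure (Vals Ω τ) → Prop)
    (hφ : ∀ τ ∈ G.components, ∀ z π π', φ τ z π → φ τ z π' → π = π')
    (hQ : ∀ τ ∈ G.components, ∃ η : Kernel (Vals Ω (G.pa τ)) (Vals Ω τ), IsMarkovKernel η ∧
      DrawnFrom G Q τ η ∧ ∀ᵐ x ∂Q, φ τ ((G.pa τ).restrict x) (η ((G.pa τ).restrict x)))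
    (hQ' : ∀ τ ∈ G.components, ∃ η : Kernel (Vals Ω (G.pa τ)) (Vals Ω τ), IsMarkovKernel η ∧
      DrawnFrom G Q' τ η ∧ ∀ᵐ z ∂(Q'.map (G.pa τ).restrict), φ τ z (η z)) : Q = Q' := by
  have hr : ∀ A : Finset V, Measurable (A.restrict : (∀ j, Ω j) → Vals Ω A) :=
    fun A => Finset.measurable_restrict _
  have key : ∀ A : Finset V, G.IsAncestral A → Q.map A.restrict = Q'.map A.restrict := by
    intro A
    induction A using Finset.strongInduction with
    | H A ih =>
      intro hA
      rcases A.eq_empty_or_nonempty with rfl | hne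
      · have := Measure.isProbabilityMeasure_map (μ := Q) (hr ∅).aemeasurable
        have := Measure.isProbabilityMeasure_map (μ := Q') (hr ∅).aemeasurable
        ext s _
        rcases s.eq_empty_or_nonempty with rfl | hs
        · simp
        · rw [Subsingleton.eq_univ_of_nonempty hs, measure_univ, measure_univ]
      obtain ⟨τ, hτ, hτA, -, hAτ, hpa⟩ :=
        ChainGraph.exists_terminal_component isAncestral_empty hA (by simpa using hne)
      have hss : A \ τ ⊂ A := Finset.sdiff_ssubset hτA (ChainGraph.nonempty_of_mem_components hτ)
      have hnd : A \ τ ⊆ G.nonDesc τ :=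
        ChainGraph.subset_nonDesc_of_isAncestral hAτ Finset.disjoint_sdiff
      have ih := ih _ hss hAτ
      obtain ⟨η, _, hη, hηφ⟩ := hQ τ hτ
      obtain ⟨η', _, hη', hη'φ⟩ := hQ' τ hτ
      have hpaeq : Q.map (G.pa τ).restrict = Q'.map (G.pa τ).restrict := by
        have := congrArg (Measure.map (Finset.restrict₂ (π := Ω) hpa)) ih
        rwa [Measure.map_map (Finset.measurable_restrict₂ hpa) (hr _),
          Measure.map_map (Finset.measurable_restrict₂ hpa) (hr _)] at this
      rw [← hpaeq] at hη'φ
      have hQeq : ∀ᵐ x ∂Q, η ((G.pa τ).restrict x) = η' ((G.pa τ).restrict x) := by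
        filter_upwards [hηφ, ae_of_ae_map (hr _).aemeasurable hη'φ] with x h1 h2
        exact hφ τ hτ _ _ _ h1 h2
      refine map_restrict_eq_of_map_prod (A := A \ τ) (B := τ)
        (Finset.sdiff_union_of_subset hτA).ge ?_
      rw [hη.map_restrict hnd hpa, hη'.map_restrict hnd hpa, ← ih]
      have := Measure.isProbabilityMeasure_map (μ := Q) (hr (A \ τ)).aemeasurable
      refine Measure.ext_of_lintegral _ fun f hf => ?_
      rw [Measure.lintegral_compProd hf, Measure.lintegral_compProd hf,
        lintegral_map hf.lintegral_kernel_prod_right' (hr _),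
        lintegral_map hf.lintegral_kernel_prod_right' (hr _)]
      refine lintegral_congr_ae ?_
      filter_upwards [hQeq] with x hx
      simp only [Kernel.comap_apply]
      exact congrArg (fun m => ∫⁻ y, f ((A \ τ).restrict x, y) ∂m) hx
  have h := key Finset.univ isAncestral_univ
  let g : Vals Ω Finset.univ → ∀ j, Ω j := fun y j => y ⟨j, Finset.mem_univ j⟩
  have hg : Measurable g := measurable_pi_lambda _ fun j => measurable_pi_apply _
  have h1 := congrArg (Measure.map g) h
  rw [Measure.map_map hg (hr _), Measure.map_map hg (hr _)] at h1
  have h2 : g ∘ (Finset.univ : Finset V).restrict = id := rfl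
  rwa [h2, Measure.map_id, Measure.map_id] at h1

end UniquenessOfLaws

/-! ### Assignments in components with confounding -/

section ConditionalDensities

open Function

variable {V : Type*} [Fintype V] [DecidableEq V] {Ω : V → Type*} [∀ j, MeasurableSpace (Ω j)]
  {μ : ∀ j, Measure (Ω j)} [∀ j, SigmaFinite (μ j)] {p : (∀ j, Ω j) → ℝ≥0∞}

/-- Integrating out some of the variables of a conditional density gives the conditional density of
the others, at every point: this is why `condInt` falls back on the unconditional density. -/
lemma lmarginal_condInt_union (hp : Measurable p) {A B C : Finset V} (hA : Disjoint A C)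
    (hB : Disjoint B C) :
    ∫⋯∫⁻_C, condInt μ p (B ∪ C) A ∂μ = condInt μ p B A := by
  ext x
  have hq : ∀ y, margInt μ p A (updateFinset x C y) = margInt μ p A x := fun y =>
    updateFinset_eq_self_of_dependsOn dependsOn_margInt
      (fun i hi h => Finset.disjoint_left.1 hA h hi) x y
  by_cases h : margInt μ p A x = ∞
  · simp only [lmarginal, condInt, hq, h, if_true]
    exact congrFun (lmarginal_margInt hp hB) x
  · simp only [lmarginal, condInt, hq, h, if_false, div_eq_mul_inv]
    rw [lintegral_mul_const _ ((measurable_margInt hp).updateFinset_right _ _), ← Finset.union_assoc]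
    congr 1
    exact congrFun (lmarginal_margInt hp (Finset.disjoint_union_left.2 ⟨hA, hB⟩)) x

end ConditionalDensities

section Confounding

open Function

variable {V : Type*} [Fintype V] [DecidableEq V] {Ω : V → Type*} [∀ j, MeasurableSpace (Ω j)]
  {G : ChainGraph V} {τ : Finset V}

lemma measurable_pi_measure {Z ι : Type*} [MeasurableSpace Z] [Fintype ι] {X : ι → Type*}
    [∀ i, MeasurableSpace (X i)] {κ : ∀ i, Z → Measure (X i)} (hκ : ∀ i, Measurable (κ i))
    [∀ i z, IsProbabilityMeasure (κ i z)] : Measurable fun z => Measure.pi fun i => κ i z := by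
  refine Measurable.measure_of_isPiSystem_of_isProbabilityMeasure generateFrom_pi.symm
    isPiSystem_pi ?_
  rintro _ ⟨t, ht, rfl⟩
  simp only [Measure.pi_pi]
  exact Finset.measurable_fun_prod _ fun i _ =>
    (Measure.measurable_coe (ht i (Set.mem_univ i))).comp (hκ i)

/-- Replace the values of the variables in `S` by the assigned ones. -/
def overwrite (S : Finset V) (xS : Vals Ω S) (y : Vals Ω τ) : Vals Ω τ := fun j =>
  if h : (j : V) ∈ S then xS ⟨j, h⟩ else y j

omit [Fintype V] in
lemma measurable_overwrite (S : Finset V) (xS : Vals Ω S) :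
    Measurable (overwrite (τ := τ) S xS) := by
  refine measurable_pi_lambda _ fun j => ?_
  by_cases h : (j : V) ∈ S
  · simp [overwrite, h]
  · simpa [overwrite, h] using measurable_pi_apply j

lemma ConfoundingMechanism.measurable_draw (m : ConfoundingMechanism G Ω τ) (S : Finset V)
    (xS : Vals Ω S) (xpa : Vals Ω (G.pa τ)) :
    Measurable fun z => Measure.pi fun j : τ =>
      if h : (j : V) ∈ S then Measure.dirac (xS ⟨j, h⟩) else m.draw j (xpa, z) := by
  have : ∀ (j : τ) (z : m.Z), IsProbabilityMeasure
      (if h : (j : V) ∈ S then Measure.dirac (xS ⟨j, h⟩) else m.draw j (xpa, z)) := fun j z => by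
    split_ifs <;> infer_instance
  refine measurable_pi_measure fun j => ?_
  by_cases h : (j : V) ∈ S
  · simp [h]
  · simp only [h, dif_neg, not_false_eq_true]
    exact (m.draw j).measurable.comp measurable_prodMk_left

/-- With confounding, assigning values after the draws is the same as replacing the draws by the
assignments, because no draw is affected by another one. -/
lemma ConfoundingMechanism.response_eq_map (m : ConfoundingMechanism G Ω τ) (S : Finset V)
    (xS : Vals Ω S) (e : Vals Ω ∅) (xpa : Vals Ω (G.pa τ)) :
    m.response S xS xpa = (m.response ∅ e xpa).map (overwrite S xS) := by
  ext s hs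
  rw [Measure.map_apply (measurable_overwrite S xS) hs, response, response,
    Measure.bind_apply hs (m.measurable_draw S xS xpa).aemeasurable,
    Measure.bind_apply (measurable_overwrite S xS hs) (m.measurable_draw ∅ e xpa).aemeasurable]
  congr 1
  ext z
  rw [← Measure.map_apply (measurable_overwrite S xS) hs]
  congr 1
  simp only [Finset.notMem_empty, dif_neg, not_false_eq_true]
  let f : ∀ j : τ, Ω j → Ω j := fun j t => if h : (j : V) ∈ S then xS ⟨j, h⟩ else t
  have hf : ∀ j, Measurable (f j) := fun j => by
    by_cases h : (j : V) ∈ S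
    · simp [f, h]
    · simp only [f, h, dif_neg, not_false_eq_true]; exact measurable_id
  have := Measure.pi_map_pi (μ := fun j : τ => m.draw j (xpa, z)) (f := f)
    fun j => (hf j).aemeasurable
  refine Eq.trans ?_ this.symm
  congr 1
  ext1 j
  by_cases h : (j : V) ∈ S
  · simp [f, h, Measure.map_const]
  · simp [f, h]

variable {μ : ∀ j, Measure (Ω j)} [∀ j, SigmaFinite (μ j)] {p : (∀ j, Ω j) → ℝ≥0∞}

/-- The response of a component with confounding has the conditional density, given the parents, of
the variables that are not assigned. -/
lemma ConfoundingMechanism.response_eq_densityKernel (m : ConfoundingMechanism G Ω τ)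
    (hτ : τ ∈ G.components) (hp : Measurable p) (S : Finset V) (xS : Vals Ω S) (e : Vals Ω ∅)
    (x₀ x : ∀ j, Ω j) (hx : ∀ j (h : j ∈ S), x j = xS ⟨j, h⟩)
    (h : m.response ∅ e ((G.pa τ).restrict x) =
      densityKernel μ (condInt μ p τ (G.pa τ)) x₀ (G.pa τ) τ ((G.pa τ).restrict x)) :
    m.response S xS ((G.pa τ).restrict x) =
      densityKernel (doRef μ S xS) (condInt μ p (τ ∩ Sᶜ) (G.pa τ)) x₀ (G.pa τ) τ
        ((G.pa τ).restrict x) := by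
  have hpa := ChainGraph.disjoint_pa hτ
  have hd := measurable_condInt (μ := μ) (B := τ ∩ Sᶜ) (A := G.pa τ) hp
  have hdd : DependsOn (condInt μ p (τ ∩ Sᶜ) (G.pa τ)) ((G.pa τ ∪ τ : Finset V) : Set V) :=
    dependsOn_condInt.mono (Finset.coe_subset.2
      (Finset.union_subset_union_right Finset.inter_subset_left))
  have hsplit : τ = (τ ∩ Sᶜ) ∪ (τ ∩ S) := by
    ext i; simp only [Finset.mem_union, Finset.mem_inter, Finset.mem_compl]; tauto
  have hdis : Disjoint (τ ∩ Sᶜ) (τ ∩ S) := Finset.disjoint_left.2 fun i hi hi' => by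
    simp only [Finset.mem_inter, Finset.mem_compl] at hi hi'; exact hi.2 hi'.2
  refine Measure.ext_of_lintegral _ fun f hf => ?_
  have hov := measurable_overwrite (Ω := Ω) (τ := τ) S xS
  have hF : Measurable fun x : ∀ j, Ω j => f (overwrite S xS (τ.restrict x)) :=
    (hf.comp hov).restrict_left
  have hFd : DependsOn (fun x : ∀ j, Ω j => f (overwrite S xS (τ.restrict x)))
      ((Sᶜ : Finset V) : Set V) := fun x y hxy => by
    have : overwrite S xS (τ.restrict x) = overwrite S xS (τ.restrict y) := by
      ext j
      by_cases h : (j : V) ∈ S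
      · simp [overwrite, h]
      · simpa [overwrite, h] using hxy j (by simpa using h)
    simp only [this]
  have hl := lintegral_densityKernel (ν := doRef μ S xS) (x₀ := x₀) hd hdd
    (F := fun x => f (τ.restrict x)) hf.restrict_left x
  have hr := lintegral_densityKernel (ν := μ) (x₀ := x₀)
    (measurable_condInt (μ := μ) (B := τ) (A := G.pa τ) hp) dependsOn_condInt hF x
  simp only [restrict_updateFinset] at hl hr
  have hgen : ∀ T, T = (τ ∩ Sᶜ) ∪ (τ ∩ S) →
      ∫⋯∫⁻_T, (fun x => f (overwrite S xS (τ.restrict x)) * condInt μ p T (G.pa τ) x) ∂μ =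
      ∫⋯∫⁻_(τ ∩ Sᶜ), (fun x => f (overwrite S xS (τ.restrict x)) *
        condInt μ p (τ ∩ Sᶜ) (G.pa τ) x) ∂μ := by
    rintro _ rfl
    rw [lmarginal_union μ (fun x => f (overwrite S xS (τ.restrict x)) *
      condInt μ p ((τ ∩ Sᶜ) ∪ (τ ∩ S)) (G.pa τ) x) (hF.mul (measurable_condInt hp)) hdis,
      lmarginal_mul_left μ hFd (by simp +contextual) (measurable_condInt hp),
      lmarginal_condInt_union hp (hpa.mono_right Finset.inter_subset_left) hdis]
  rw [m.response_eq_map S xS e, lintegral_map hf hov, h, hl, hr,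
    lmarginal_doRef (t := τ ∩ Sᶜ)
      (f := fun x => condInt μ p (τ ∩ Sᶜ) (G.pa τ) x * f (τ.restrict x))
      (Finset.disjoint_left.2 fun i hi => Finset.mem_compl.1 (Finset.mem_inter.1 hi).2)
      (fun i hi => (Finset.mem_inter.1 hi).1) (by simp +contextual)
      (hd.mul hf.restrict_left) hx]
  simp only [mul_comm (condInt μ p _ _ _)]
  rw [hgen τ hsplit]
  refine lmarginal_congr_of_ae μ (Filter.Eventually.of_forall fun y => ?_)
  have : overwrite S xS (τ.restrict (updateFinset x (τ ∩ Sᶜ) y)) =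
      τ.restrict (updateFinset x (τ ∩ Sᶜ) y) := by
    ext j
    by_cases h : (j : V) ∈ S
    · simp [overwrite, h, updateFinset_def, hx j h]
    · simp [overwrite, h]
  rw [this]

end Confounding

/-! ### Assignments in components with Gibbs updates -/

section Gibbs

open Function

variable {V : Type*} [Fintype V] [DecidableEq V] {Ω : V → Type*} [∀ j, MeasurableSpace (Ω j)]
  {μ : ∀ j, Measure (Ω j)} [∀ j, SigmaFinite (μ j)] {p : (∀ j, Ω j) → ℝ≥0∞}
  {G : ChainGraph V} {τ : Finset V}

/-- A Gibbs update has the conditional density of the updated variable, given the parents and the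
other variables of the component. -/
lemma InteractionMechanism.lintegral_update_ae [∀ j, StandardBorelSpace (Ω j)]
    (m : InteractionMechanism G Ω μ τ) (hτ : τ ∈ G.components) (hp : Measurable p)
    (hp0 : ∀ x, p x ≠ 0) (hp1 : ∫⁻ x, p x ∂(Measure.pi μ) = 1) (j : τ)
    (h : ((Measure.pi μ).withDensity p).map
        (fun x => (((G.pa τ).restrict x, others j (τ.restrict x)), x j)) =
      ((Measure.pi μ).withDensity p).map
        (fun x => ((G.pa τ).restrict x, others j (τ.restrict x))) ⊗ₘ m.update j) :
    ∀ᵐ x ∂(Measure.pi μ), ∀ g : (∀ j, Ω j) → ℝ≥0∞, Measurable g →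
      ∫⁻ t, g (Function.update x j t) ∂(m.update j ((G.pa τ).restrict x, others j (τ.restrict x))) =
        (∫⋯∫⁻_{(j : V)}, (fun x => condInt μ p {(j : V)} (G.pa τ ∪ τ.erase j) x * g x) ∂μ) x := by
  rcases isEmpty_or_nonempty (∀ j, Ω j) with he | ⟨⟨x₀⟩⟩
  · exact Filter.Eventually.of_forall fun x => he.elim x
  set P := (Measure.pi μ).withDensity p with hP
  have : IsProbabilityMeasure P := ⟨by rw [hP, withDensity_apply _ .univ, Measure.restrict_univ, hp1]⟩
  have hr : ∀ A : Finset V, Measurable (A.restrict : (∀ j, Ω j) → Vals Ω A) :=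
    fun A => Finset.measurable_restrict _
  set A := G.pa τ ∪ τ.erase j with hA
  have hjA : (j : V) ∉ A := fun hj => (Finset.mem_union.1 hj).elim
    (fun h => Finset.disjoint_left.1 (ChainGraph.disjoint_pa hτ) h j.2) (by simp)
  -- The given values, as a function of all variables, and of those in `A` only.
  let src : (∀ j, Ω j) → Vals Ω (G.pa τ) × (∀ i : {i : τ // i ≠ j}, Ω i) := fun x =>
    ((G.pa τ).restrict x, others j (τ.restrict x))
  have hsrc : Measurable src := (hr _).prodMk ((measurable_others j).comp (hr _))
  have hsrcA : ∀ x, src (updateFinset x₀ A (A.restrict x)) = src x := fun x => by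
    have hA' : ∀ i ∈ A, updateFinset x₀ A (A.restrict x) i = x i := fun i hi => by
      simp [updateFinset_def, hi]
    refine Prod.ext (funext fun i => hA' i (Finset.mem_union_left _ i.2)) (funext fun i => ?_)
    refine hA' _ (Finset.mem_union_right _ (Finset.mem_erase.2 ⟨fun h => i.2 (Subtype.ext h), i.1.2⟩))
  have hsA : Measurable fun a : Vals Ω A => src (updateFinset x₀ A a) :=
    hsrc.comp measurable_updateFinset
  -- A value of variable `j` as a configuration on the singleton, without casts.
  let emb : Ω j → Vals Ω {(j : V)} := fun t => ({(j : V)} : Finset V).restrict (Function.update x₀ j t)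
  have hemb : Measurable emb := (hr _).comp (measurable_update x₀)
  have hembx : ∀ x : ∀ j, Ω j, emb (x j) = ({(j : V)} : Finset V).restrict x := fun x => by
    ext ⟨i, hi⟩
    obtain rfl := Finset.mem_singleton.1 hi
    simp [emb]
  let κ : Kernel (Vals Ω A) (Vals Ω {(j : V)}) := ((m.update j).comap _ hsA).map emb
  have : IsMarkovKernel κ := Kernel.IsMarkovKernel.map _ hemb
  -- A configuration with the given values on `A`.
  let reb : Vals Ω (G.pa τ) × (∀ i : {i : τ // i ≠ j}, Ω i) → ∀ j, Ω j := fun u i =>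
    if hi : i ∈ G.pa τ then u.1 ⟨i, hi⟩
    else if hi : ∃ h : i ∈ τ, (⟨i, h⟩ : τ) ≠ j then u.2 ⟨⟨i, hi.1⟩, hi.2⟩ else x₀ i
  have hreb : Measurable reb := by
    refine measurable_pi_lambda _ fun i => ?_
    by_cases hi : i ∈ G.pa τ
    · simpa only [reb, hi, dif_pos] using measurable_pi_iff.1 measurable_fst _
    by_cases hi' : ∃ h : i ∈ τ, (⟨i, h⟩ : τ) ≠ j
    · simp only [reb, hi, hi', dif_pos, dif_neg, not_false_eq_true]
      exact measurable_pi_iff.1 measurable_snd _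
    · simp only [reb, hi, hi', dif_neg, not_false_eq_true]
      exact measurable_const
  have hrebA : ∀ x, A.restrict (reb (src x)) = A.restrict x := fun x => by
    ext ⟨i, hi⟩
    by_cases hpa : i ∈ G.pa τ
    · simp [reb, src, hpa]
    · have h1 := (Finset.mem_union.1 hi).resolve_left hpa
      have h2 : ∃ h : i ∈ τ, (⟨i, h⟩ : τ) ≠ j := ⟨(Finset.mem_erase.1 h1).2, fun h =>
        (Finset.mem_erase.1 h1).1 (congrArg Subtype.val h)⟩
      simp only [Finset.restrict, reb, hpa, h2, dif_pos, dif_neg, not_false_eq_true, src, others]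
  have hκ : P.map (fun x => (A.restrict x, ({(j : V)} : Finset V).restrict x)) =
      P.map A.restrict ⊗ₘ κ := by
    have hΨ : Measurable fun q : (Vals Ω (G.pa τ) × (∀ i : {i : τ // i ≠ j}, Ω i)) × Ω j =>
        (A.restrict (reb q.1), emb q.2) :=
      ((hr A).comp (hreb.comp measurable_fst)).prodMk (hemb.comp measurable_snd)
    have h1 := congrArg (Measure.map fun q : (Vals Ω (G.pa τ) ×
      (∀ i : {i : τ // i ≠ j}, Ω i)) × Ω j => (A.restrict (reb q.1), emb q.2)) h
    have hsj : Measurable fun x : ∀ j, Ω j => (src x, x j) := hsrc.prodMk (measurable_pi_apply _)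
    rw [Measure.map_map hΨ hsj] at h1
    have h2 : ((fun q : (Vals Ω (G.pa τ) × (∀ i : {i : τ // i ≠ j}, Ω i)) × Ω j =>
        (A.restrict (reb q.1), emb q.2)) ∘ fun x : ∀ j, Ω j => (src x, x j)) =
        fun x => (A.restrict x, ({(j : V)} : Finset V).restrict x) := by
      ext1 x
      exact Prod.ext (hrebA x) (hembx x)
    have h3 : P.map (fun x => (A.restrict x, ({(j : V)} : Finset V).restrict x)) =
        (P.map src ⊗ₘ m.update j).map fun q => (A.restrict (reb q.1), emb q.2) := by
      rw [← h2]; exact h1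
    rw [h3]
    have := Measure.isProbabilityMeasure_map (μ := P) hsrc.aemeasurable
    have := Measure.isProbabilityMeasure_map (μ := P) (hr A).aemeasurable
    refine Measure.ext_of_lintegral _ fun f hf => ?_
    have hf' : Measurable fun q : (Vals Ω (G.pa τ) × (∀ i : {i : τ // i ≠ j}, Ω i)) × Ω j =>
      f (A.restrict (reb q.1), emb q.2) := hf.comp hΨ
    rw [lintegral_map hf hΨ, Measure.lintegral_compProd hf', Measure.lintegral_compProd hf,
      lintegral_map hf'.lintegral_kernel_prod_right' hsrc,
      lintegral_map hf.lintegral_kernel_prod_right' (hr A)]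
    refine lintegral_congr fun x => ?_
    simp only [κ]
    rw [Kernel.map_apply _ hemb, Kernel.comap_apply, hsrcA, hrebA,
      lintegral_map (f := fun b => f (A.restrict x, b)) (hf.comp measurable_prodMk_left) hemb]
  have hdisj : Disjoint A {(j : V)} := Finset.disjoint_singleton_right.2 hjA
  filter_upwards [condLaw_ae_eq_densityKernel hp hp0 hp1 hdisj κ hκ x₀] with x hx g hg
  have hl := lintegral_densityKernel (ν := μ) (x₀ := x₀)
    (measurable_condInt (μ := μ) (B := {(j : V)}) (A := A) hp) dependsOn_condInt hg x
  rw [← hl, ← hx]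
  simp only [κ]
  rw [Kernel.map_apply _ hemb, Kernel.comap_apply, hsrcA,
    lintegral_map (f := fun b => g (updateFinset x {(j : V)} b)) (hg.updateFinset_right _ _) hemb]
  refine lintegral_congr fun t => ?_
  rw [updateFinset_singleton]
  simp [emb]

/-- Under Gibbs updates, the conditional law of the variables that are not assigned, given the
parents and the assigned variables of the component, is an equilibrium: each single update is a draw
from the conditional law of the updated variable, hence leaves it unchanged. -/
lemma InteractionMechanism.isEquilibrium_densityKernel
    (m : InteractionMechanism G Ω μ τ) (hτ : τ ∈ G.components) (hp : Measurable p)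
    (hp0 : ∀ x, p x ≠ 0) (hp1 : ∫⁻ x, p x ∂(Measure.pi μ) = 1) (S : Finset V) (xS : Vals Ω S)
    (x₀ x : ∀ j, Ω j)
    (hx : ∀ᵐ y ∂(Measure.pi fun i : τ => doRef μ S xS i),
      (∀ j (h : j ∈ S), updateFinset x τ y j = xS ⟨j, h⟩) ∧
      (∀ A, margInt μ p A (updateFinset x τ y) ≠ ∞) ∧
      ∀ j : τ, ∀ g : (∀ j, Ω j) → ℝ≥0∞, Measurable g →
        ∫⁻ t, g (Function.update (updateFinset x τ y) j t)
          ∂(m.update j ((G.pa τ).restrict x, others j y)) =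
        (∫⋯∫⁻_{(j : V)}, (fun x => condInt μ p {(j : V)} (G.pa τ ∪ τ.erase j) x * g x) ∂μ)
          (updateFinset x τ y)) :
    m.IsEquilibrium S xS ((G.pa τ).restrict x)
      (densityKernel (doRef μ S xS) (condInt μ p (τ ∩ Sᶜ) (G.pa τ ∪ (τ ∩ S))) x₀ (G.pa τ) τ
        ((G.pa τ).restrict x)) := by
  have hμ : Measure.pi μ ≠ 0 := fun h => by simp [h] at hp1
  have hpa := ChainGraph.disjoint_pa hτ
  set B := G.pa τ ∪ (τ ∩ S) with hB
  set d := condInt μ p (τ ∩ Sᶜ) B with hdef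
  have hd : Measurable d := measurable_condInt hp
  have hBτ : B ∪ (τ ∩ Sᶜ) = G.pa τ ∪ τ := by
    ext i; simp only [hB, Finset.mem_union, Finset.mem_inter, Finset.mem_compl]; tauto
  have hdd : DependsOn d ((G.pa τ ∪ τ : Finset V) : Set V) := by
    rw [← hBτ]; exact dependsOn_condInt
  have hBdis : Disjoint B (τ ∩ Sᶜ) := Finset.disjoint_left.2 fun i hi hi' => by
    have : i ∈ G.pa τ → i ∉ τ := fun h => Finset.disjoint_left.1 hpa h
    simp only [hB, Finset.mem_union, Finset.mem_inter, Finset.mem_compl] at hi hi'; tauto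
  have hd1 : ∀ x, (∫⋯∫⁻_τ, d ∂(doRef μ S xS)) x = 1 :=
    lmarginal_doRef_eq_one (t := τ ∩ Sᶜ)
      (Finset.disjoint_left.2 fun i hi => Finset.mem_compl.1 (Finset.mem_inter.1 hi).2)
      (fun i hi => (Finset.mem_inter.1 hi).1) (by simp +contextual) hd
      (lmarginal_condInt hp hp0 hp1 hBdis)
  have hM : IsMarkovKernel (densityKernel (doRef μ S xS) d x₀ (G.pa τ) τ) :=
    isMarkovKernel_densityKernel hd hd1
  refine ⟨inferInstance, ?_⟩
  have hstep : ∀ j, (densityKernel (doRef μ S xS) d x₀ (G.pa τ) τ ((G.pa τ).restrict x)).bind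
      (m.step S xS ((G.pa τ).restrict x) j) =
      densityKernel (doRef μ S xS) d x₀ (G.pa τ) τ ((G.pa τ).restrict x) := by
    intro j
    rw [← m.coe_stepKernel]
    refine Measure.ext_of_lintegral _ fun g hg => ?_
    rw [Measure.lintegral_bind (Kernel.aemeasurable _) hg.aemeasurable]
    have hF : Measurable fun z : Vals Ω τ =>
        ∫⁻ y, g y ∂(m.stepKernel S xS ((G.pa τ).restrict x) j z) := hg.lintegral_kernel
    have hl := lintegral_densityKernel (ν := doRef μ S xS) (x₀ := x₀) hd hdd hF.restrict_left x
    have hr := lintegral_densityKernel (ν := doRef μ S xS) (x₀ := x₀) hd hdd hg.restrict_left x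
    simp only [restrict_updateFinset] at hl hr
    rw [hl, hr]
    by_cases hj : (j : V) ∈ S
    · -- An assignment does not change a configuration that has the assigned values already.
      refine lmarginal_congr_of_ae _ ?_
      filter_upwards [hx] with y hy
      rw [m.stepKernel_apply, InteractionMechanism.step, dif_pos hj, lintegral_dirac' _ hg]
      congr 2
      refine Function.update_eq_self_iff.2 ?_
      rw [← hy.1 j hj]; rfl
    set c := condInt μ p {(j : V)} (G.pa τ ∪ τ.erase j) with hcdef
    have hc : Measurable c := measurable_condInt hp
    have hg' : Measurable fun x : ∀ j, Ω j => g (τ.restrict x) := hg.restrict_left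
    have hcg : Measurable fun x : ∀ j, Ω j => c x * g (τ.restrict x) := hc.mul hg'
    have hLd : Measurable (∫⋯∫⁻_{(j : V)}, d ∂μ) := hd.lmarginal μ
    have hdep : ∀ f : (∀ j, Ω j) → ℝ≥0∞,
        DependsOn (∫⋯∫⁻_{(j : V)}, f ∂μ) (({(j : V)} : Set V)ᶜ) := fun f =>
      DependsOn.lmarginal μ (dependsOn_univ f) _ fun i _ h => by simpa using h
    -- Symmetry of averaging over variable `j`.
    have hsymm : (∫⋯∫⁻_τ, (fun x => d x * (∫⋯∫⁻_{(j : V)}, (fun x => c x * g (τ.restrict x)) ∂μ) x)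
          ∂(doRef μ S xS)) =
        ∫⋯∫⁻_τ, (fun x => (∫⋯∫⁻_{(j : V)}, d ∂μ) x * (c x * g (τ.restrict x))) ∂(doRef μ S xS) := by
      have hins : {(j : V)} ⊆ τ := Finset.singleton_subset_iff.2 j.2
      refine lmarginal_eq_of_subset hins (hd.mul (hcg.lmarginal μ)) (hLd.mul hcg) ?_
      rw [lmarginal_doRef_of_disjoint (Finset.disjoint_singleton_left.2 hj),
        lmarginal_doRef_of_disjoint (Finset.disjoint_singleton_left.2 hj),
        lmarginal_mul_left μ (hdep d) (by simp) hcg]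
      simp only [mul_comm (d _)]
      rw [lmarginal_mul_left μ (hdep _) (by simp) hd]
      simp only [mul_comm]
    have h1 : (∫⋯∫⁻_τ, (fun x' => d x' * ∫⁻ y, g y
          ∂(m.stepKernel S xS ((G.pa τ).restrict x) j (τ.restrict x'))) ∂(doRef μ S xS)) x =
        (∫⋯∫⁻_τ, (fun x => d x * (∫⋯∫⁻_{(j : V)}, (fun x => c x * g (τ.restrict x)) ∂μ) x)
          ∂(doRef μ S xS)) x := by
      refine lmarginal_congr_of_ae _ ?_
      filter_upwards [hx] with y hy
      rw [← hy.2.2 j _ hg', m.stepKernel_apply, InteractionMechanism.step, dif_neg hj,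
        lintegral_map hg (measurable_update _), restrict_updateFinset]
      congr 1
      refine lintegral_congr fun t => ?_
      congr 1
      ext i
      by_cases hi : i = j
      · subst hi; simp
      · have : (i : V) ≠ j := fun h => hi (Subtype.ext h)
        simp [hi, this, updateFinset_def]
    rw [h1, hsymm]
    refine lmarginal_congr_of_ae _ ?_
    filter_upwards [hx] with y hy
    rw [← mul_assoc]
    congr 1
    set z := updateFinset x τ y
    have hjτ : (j : V) ∈ τ ∩ Sᶜ := by simp [hj]
    have e1 : τ ∩ Sᶜ = (τ ∩ Sᶜ).erase j ∪ {(j : V)} := by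
      rw [Finset.union_comm, ← Finset.insert_eq, Finset.insert_erase hjτ]
    have e2 : B ∪ (τ ∩ Sᶜ).erase j = G.pa τ ∪ τ.erase j := by
      ext i
      have : i ∈ G.pa τ → i ∉ τ := fun h => Finset.disjoint_left.1 hpa h
      simp only [hB, Finset.mem_union, Finset.mem_inter, Finset.mem_compl, Finset.mem_erase]
      by_cases hij : i = j
      · subst hij
        have : (j : V) ∉ G.pa τ := fun h => this h j.2
        simp [this, hj]
      · tauto
    have e3 : G.pa τ ∪ τ.erase j ∪ {(j : V)} = B ∪ (τ ∩ Sᶜ) := by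
      rw [hBτ, Finset.union_assoc, Finset.union_comm (τ.erase j), ← Finset.insert_eq,
        Finset.insert_erase j.2]
    have hLdz : (∫⋯∫⁻_{(j : V)}, d ∂μ) z = margInt μ p (G.pa τ ∪ τ.erase j) z / margInt μ p B z := by
      rw [hdef, e1, lmarginal_condInt_union hp
        (Finset.disjoint_singleton_right.2 fun h => Finset.disjoint_left.1 hBdis h hjτ)
        (Finset.disjoint_singleton_right.2 (Finset.notMem_erase _ _)),
        condInt_of_ne_top (hy.2.1 _), e2]
    rw [hLdz, hcdef, condInt_of_ne_top (hy.2.1 _), hdef, condInt_of_ne_top (hy.2.1 _), e3,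
      mul_comm, div_eq_mul_inv, div_eq_mul_inv, div_eq_mul_inv, mul_assoc,
      ENNReal.inv_mul_cancel_left (margInt_ne_zero hp hp0 hμ z) (hy.2.1 _)]
  simp only [hstep, Finset.sum_smul]

end Gibbs

/-! ### The law under an intervention -/

section InterventionalLaw

open Function

variable {V : Type*} [Fintype V] [DecidableEq V] {Ω : V → Type*} [∀ j, MeasurableSpace (Ω j)]
  {μ : ∀ j, Measure (Ω j)}

namespace CausalChainGraph

/-- The factor of the interventional density that belongs to the component `τ`, in terms of the
everywhere normalised conditional densities. -/
noncomputable def doFactor (C : CausalChainGraph V Ω μ) (p : (∀ j, Ω j) → ℝ≥0∞) (S τ : Finset V) :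
    (∀ j, Ω j) → ℝ≥0∞ :=
  if τ ∈ C.confounded then condInt μ p (τ ∩ Sᶜ) (C.pa τ)
  else condInt μ p (τ ∩ Sᶜ) (C.pa τ ∪ (τ ∩ S))

/-- `π` is a law of `X_τ` which the process of the component `τ` produces, subject to the
assignments, when the parents have the values `z`. -/
def Produces (C : CausalChainGraph V Ω μ) (S : Finset V) (xS : Vals Ω S) (τ : Finset V)
    (z : Vals Ω (C.pa τ)) (π : Measure (Vals Ω τ)) : Prop :=
  (∀ h : τ ∈ C.confounded, π = (C.confounding τ h).response S xS z) ∧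
    ∀ h : τ ∈ C.components \ C.confounded, (C.interaction τ h).IsEquilibrium S xS z π

/-- The pointwise properties of the observational densities and kernels which are used; they hold for
almost all configurations. -/
structure IsRegular [∀ j, SigmaFinite (μ j)] (C : CausalChainGraph V Ω μ) (P : Measure (∀ j, Ω j))
    (p : (∀ j, Ω j) → ℝ≥0∞) (x₀ : ∀ j, Ω j) (x : ∀ j, Ω j) : Prop where
  margDensity_eq : ∀ A, margDensity μ P A x = margInt μ p A x
  ne_top : ∀ A, margInt μ p A x ≠ ∞
  confounding : ∀ τ, ∀ h : τ ∈ C.confounded,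
    (C.confounding τ h).response ∅ (fun i => absurd i.2 (Finset.notMem_empty _))
      ((C.pa τ).restrict x) =
    densityKernel μ (condInt μ p τ (C.pa τ)) x₀ (C.pa τ) τ ((C.pa τ).restrict x)
  interaction : ∀ τ, ∀ h : τ ∈ C.components \ C.confounded, ∀ j : τ,
    ∀ g : (∀ j, Ω j) → ℝ≥0∞, Measurable g →
    ∫⁻ t, g (Function.update x j t)
      ∂((C.interaction τ h).update j ((C.pa τ).restrict x, others j (τ.restrict x))) =
    (∫⋯∫⁻_{(j : V)}, (fun x => condInt μ p {(j : V)} (C.pa τ ∪ τ.erase j) x * g x) ∂μ) x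

variable {C : CausalChainGraph V Ω μ} {p : (∀ j, Ω j) → ℝ≥0∞} {S : Finset V} {xS : Vals Ω S}
  {P : Measure (∀ j, Ω j)} {x₀ : ∀ j, Ω j}

lemma Produces.unique [∀ j, SigmaFinite (μ j)] (hμ : Measure.pi μ ≠ 0) {τ : Finset V}
    (hτ : τ ∈ C.components) {z : Vals Ω (C.pa τ)} {π π' : Measure (Vals Ω τ)}
    (h : C.Produces S xS τ z π) (h' : C.Produces S xS τ z π') : π = π' := by
  by_cases hc : τ ∈ C.confounded
  · rw [h.1 hc, h'.1 hc]
  · have hi : τ ∈ C.components \ C.confounded := Finset.mem_sdiff.2 ⟨hτ, hc⟩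
    exact InteractionMechanism.IsEquilibrium.unique _ S xS z
      (ChainGraph.nonempty_of_mem_components hτ) hμ (h.2 hi) (h'.2 hi)

/-- The two kinds of components can be treated alike. -/
lemma isDoLaw_iff {Q : Measure (∀ j, Ω j)} :
    C.IsDoLaw S xS Q ↔ IsProbabilityMeasure Q ∧ ∀ τ ∈ C.components,
      ∃ η : Kernel (Vals Ω (C.pa τ)) (Vals Ω τ), IsMarkovKernel η ∧
        DrawnFrom C.toChainGraph Q τ η ∧
        ∀ᵐ x ∂Q, C.Produces S xS τ ((C.pa τ).restrict x) (η ((C.pa τ).restrict x)) := by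
  constructor
  · refine fun h => ⟨h.prob, fun τ hτ => ?_⟩
    by_cases hc : τ ∈ C.confounded
    · obtain ⟨η, h1, h2, h3⟩ := h.confounding τ hc
      refine ⟨η, h1, h2, ?_⟩
      filter_upwards [h3] with x hx
      exact ⟨fun _ => hx, fun h => absurd hc (Finset.mem_sdiff.1 h).2⟩
    · obtain ⟨η, h1, h2, h3⟩ := h.interaction τ (Finset.mem_sdiff.2 ⟨hτ, hc⟩)
      refine ⟨η, h1, h2, ?_⟩
      filter_upwards [h3] with x hx
      exact ⟨fun h => absurd h hc, fun _ => hx⟩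
  · rintro ⟨h1, h2⟩
    refine ⟨h1, fun τ h => ?_, fun τ h => ?_⟩
    · obtain ⟨η, h3, h4, h5⟩ := h2 τ (C.confounded_subset h)
      exact ⟨η, h3, h4, h5.mono fun x hx => hx.1 h⟩
    · obtain ⟨η, h3, h4, h5⟩ := h2 τ (Finset.mem_sdiff.1 h).1
      exact ⟨η, h3, h4, h5.mono fun x hx => hx.2 h⟩

variable [∀ j, SigmaFinite (μ j)]

lemma ae_isRegular [∀ j, StandardBorelSpace (Ω j)] (hP : C.IsObservationalLaw P)
    (hp : Measurable p) (hp0 : ∀ x, p x ≠ 0) (hPp : P = (Measure.pi μ).withDensity p)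
    (x₀ : ∀ j, Ω j) : ∀ᵐ x ∂(Measure.pi μ), C.IsRegular P p x₀ x := by
  have := hP.generated.prob
  have hp1 : ∫⁻ x, p x ∂(Measure.pi μ) = 1 := by
    rw [← measure_univ (μ := P), hPp, withDensity_apply _ .univ, Measure.restrict_univ]
  have hμP : Measure.pi μ ≪ P := by
    rw [hPp]; exact withDensity_absolutelyContinuous' hp.aemeasurable (by simp [hp0])
  have h1 : ∀ᵐ x ∂(Measure.pi μ), ∀ A, margDensity μ P A x = margInt μ p A x := by
    rw [ae_all_iff, hPp]
    exact fun A => margDensity_ae_eq hp A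
  have h2 : ∀ᵐ x ∂(Measure.pi μ), ∀ A, margInt μ p A x ≠ ∞ := by
    rw [ae_all_iff]
    exact fun A => margInt_ae_ne_top hp (by simp [hp1]) A
  have h3 : ∀ᵐ x ∂(Measure.pi μ), ∀ τ, ∀ h : τ ∈ C.confounded,
      (C.confounding τ h).response ∅ (fun i => absurd i.2 (Finset.notMem_empty _))
        ((C.pa τ).restrict x) =
      densityKernel μ (condInt μ p τ (C.pa τ)) x₀ (C.pa τ) τ ((C.pa τ).restrict x) := by
    simp only [ae_all_iff]
    intro τ h
    have hτ := C.confounded_subset h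
    obtain ⟨η, hη, hd, he⟩ := hP.generated.confounding τ h
    have h4 := hd.map_restrict (ChainGraph.pa_subset_nonDesc hτ) subset_rfl
    rw [hPp] at h4
    filter_upwards [hμP he, condLaw_ae_eq_densityKernel hp hp0 hp1 (ChainGraph.disjoint_pa hτ) _ h4
      x₀] with x hx hx'
    rw [← hx, ← hx']
    rfl
  have h4 : ∀ᵐ x ∂(Measure.pi μ), ∀ τ, ∀ h : τ ∈ C.components \ C.confounded, ∀ j : τ,
      ∀ g : (∀ j, Ω j) → ℝ≥0∞, Measurable g →
      ∫⁻ t, g (Function.update x j t)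
        ∂((C.interaction τ h).update j ((C.pa τ).restrict x, others j (τ.restrict x))) =
      (∫⋯∫⁻_{(j : V)}, (fun x => condInt μ p {(j : V)} (C.pa τ ∪ τ.erase j) x * g x) ∂μ) x := by
    refine ae_all_iff.2 fun τ => ae_all_iff.2 fun h => ae_all_iff.2 fun j => ?_
    have := hP.gibbs τ h j
    rw [hPp] at this
    exact (C.interaction τ h).lintegral_update_ae (Finset.mem_sdiff.1 h).1 hp hp0 hp1 j this
  filter_upwards [h1, h2, h3, h4] with x hx1 hx2 hx3 hx4
  exact ⟨hx1, hx2, hx3, hx4⟩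

omit [∀ j, SigmaFinite (μ j)] in
lemma disjoint_parents_inter {τ : Finset V} (hτ : τ ∈ C.components) (S : Finset V) :
    Disjoint (C.pa τ ∪ (τ ∩ S)) (τ ∩ Sᶜ) := by
  refine Finset.disjoint_left.2 fun i hi hi' => ?_
  have : i ∈ C.pa τ → i ∉ τ := fun h => Finset.disjoint_left.1 (ChainGraph.disjoint_pa hτ) h
  simp only [Finset.mem_union, Finset.mem_inter, Finset.mem_compl] at hi hi'
  tauto

lemma measurable_doFactor (hp : Measurable p) (τ : Finset V) : Measurable (C.doFactor p S τ) := by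
  unfold doFactor; split_ifs <;> exact measurable_condInt hp

omit [∀ j, SigmaFinite (μ j)] in
lemma dependsOn_doFactor (τ : Finset V) :
    DependsOn (C.doFactor p S τ) ((C.pa τ ∪ τ : Finset V) : Set V) := by
  unfold doFactor
  split_ifs
  all_goals
    refine dependsOn_condInt.mono (Finset.coe_subset.2 fun i hi => ?_)
    simp only [Finset.mem_union, Finset.mem_inter] at hi ⊢
    tauto

lemma lmarginal_doFactor (hp : Measurable p) (hp0 : ∀ x, p x ≠ 0)
    (hp1 : ∫⁻ x, p x ∂(Measure.pi μ) = 1) {τ : Finset V} (hτ : τ ∈ C.components) (x : ∀ j, Ω j) :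
    (∫⋯∫⁻_τ, C.doFactor p S τ ∂(doRef μ S xS)) x = 1 := by
  refine lmarginal_doRef_eq_one (t := τ ∩ Sᶜ)
    (Finset.disjoint_left.2 fun i hi => Finset.mem_compl.1 (Finset.mem_inter.1 hi).2)
    (fun i hi => (Finset.mem_inter.1 hi).1) (by simp +contextual) (measurable_doFactor hp τ)
    (fun x => ?_) x
  have h := disjoint_parents_inter hτ S
  unfold doFactor
  split_ifs
  · exact lmarginal_condInt hp hp0 hp1 (Finset.disjoint_union_left.1 h).1 x
  · exact lmarginal_condInt hp hp0 hp1 h x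

/-- The kernels with the factors of the interventional density as densities are produced by the
processes of the components. -/
lemma ae_produces [∀ j, StandardBorelSpace (Ω j)] (hp : Measurable p) (hp0 : ∀ x, p x ≠ 0)
    (hp1 : ∫⁻ x, p x ∂(Measure.pi μ) = 1)
    (h : ∀ᵐ x ∂(Measure.pi (doRef μ S xS)), C.IsRegular P p x₀ x) {τ : Finset V}
    (hτ : τ ∈ C.components) :
    ∀ᵐ x ∂(Measure.pi (doRef μ S xS)), C.Produces S xS τ ((C.pa τ).restrict x)
      (densityKernel (doRef μ S xS) (C.doFactor p S τ) x₀ (C.pa τ) τ ((C.pa τ).restrict x)) := by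
  have hx := ae_pi_doRef_eq (μ := μ) (S := S) (xS := xS)
  by_cases hc : τ ∈ C.confounded
  · filter_upwards [h, hx] with x h1 h2
    refine ⟨fun _ => ?_, fun h => absurd hc (Finset.mem_sdiff.1 h).2⟩
    rw [doFactor, if_pos hc]
    exact ((C.confounding τ hc).response_eq_densityKernel hτ hp S xS _ x₀ x h2
      (h1.confounding τ hc)).symm
  · filter_upwards [ae_ae_updateFinset _ (h.and hx) τ] with x h1
    refine ⟨fun h => absurd h hc, fun hi => ?_⟩
    rw [doFactor, if_neg hc]
    refine (C.interaction τ hi).isEquilibrium_densityKernel hτ hp hp0 hp1 S xS x₀ x ?_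
    filter_upwards [h1] with y hy
    refine ⟨hy.2, hy.1.ne_top, fun j g hg => ?_⟩
    have h2 := hy.1.interaction τ hi j g hg
    have h3 : (C.pa τ).restrict (updateFinset x τ y) = (C.pa τ).restrict x := by
      ext i
      simp [updateFinset_def, Finset.disjoint_left.1 (ChainGraph.disjoint_pa hτ) i.2]
    rwa [h3, restrict_updateFinset] at h2

/-- The law of the variables under the intervention, given by its density. -/
noncomputable def doLaw (C : CausalChainGraph V Ω μ) (p : (∀ j, Ω j) → ℝ≥0∞) (S : Finset V)
    (xS : Vals Ω S) : Measure (∀ j, Ω j) :=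
  (Measure.pi (doRef μ S xS)).withDensity (blockProd C.toChainGraph (C.doFactor p S) Finset.univ)

lemma isProbabilityMeasure_doLaw (hp : Measurable p) (hp0 : ∀ x, p x ≠ 0)
    (hp1 : ∫⁻ x, p x ∂(Measure.pi μ) = 1) (x₀ : ∀ j, Ω j) :
    IsProbabilityMeasure (C.doLaw p S xS) :=
  isProbabilityMeasure_blockProd (measurable_doFactor hp) (fun τ _ => dependsOn_doFactor τ)
    (fun _ hτ => lmarginal_doFactor hp hp0 hp1 hτ) x₀

lemma isDoLaw_doLaw [∀ j, StandardBorelSpace (Ω j)] (hp : Measurable p) (hp0 : ∀ x, p x ≠ 0)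
    (hp1 : ∫⁻ x, p x ∂(Measure.pi μ) = 1)
    (h : ∀ᵐ x ∂(Measure.pi (doRef μ S xS)), C.IsRegular P p x₀ x) :
    C.IsDoLaw S xS (C.doLaw p S xS) := by
  refine isDoLaw_iff.2 ⟨isProbabilityMeasure_doLaw hp hp0 hp1 x₀, fun τ hτ => ⟨_, ?_,
    drawnFrom_blockProd (measurable_doFactor hp) (fun τ _ => dependsOn_doFactor τ)
      (fun _ hτ => lmarginal_doFactor hp hp0 hp1 hτ) x₀ hτ, ?_⟩⟩
  · exact isMarkovKernel_densityKernel (measurable_doFactor hp τ) (lmarginal_doFactor hp hp0 hp1 hτ)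
  · exact (withDensity_absolutelyContinuous _ _) (ae_produces hp hp0 hp1 h hτ)

lemma IsDoLaw.eq_doLaw [∀ j, StandardBorelSpace (Ω j)] (hp : Measurable p) (hp0 : ∀ x, p x ≠ 0)
    (hp1 : ∫⁻ x, p x ∂(Measure.pi μ) = 1)
    (h : ∀ᵐ x ∂(Measure.pi (doRef μ S xS)), C.IsRegular P p x₀ x) {Q : Measure (∀ j, Ω j)}
    (hQ : C.IsDoLaw S xS Q) : Q = C.doLaw p S xS := by
  have hμ : Measure.pi μ ≠ 0 := fun h => by simp [h] at hp1
  have := hQ.prob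
  have := isProbabilityMeasure_doLaw (C := C) (S := S) (xS := xS) hp hp0 hp1 x₀
  refine eq_of_drawnFrom (C.Produces S xS) (fun τ hτ z π π' h h' => h.unique hμ hτ h')
    (isDoLaw_iff.1 hQ).2 fun τ hτ => ⟨_, ?_,
    drawnFrom_blockProd (measurable_doFactor hp) (fun τ _ => dependsOn_doFactor τ)
      (fun _ hτ => lmarginal_doFactor hp hp0 hp1 hτ) x₀ hτ, ?_⟩
  · exact isMarkovKernel_densityKernel (measurable_doFactor hp τ) (lmarginal_doFactor hp hp0 hp1 hτ)
  · have h1 := ae_pi_finset_of_ae _ (pi_doRef_ne_zero hμ) (C.pa τ) (φ := fun z =>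
      C.Produces S xS τ z (densityKernel (doRef μ S xS) (C.doFactor p S τ) x₀ (C.pa τ) τ z))
      (ae_produces hp hp0 hp1 h hτ)
    have h2 : (C.doLaw p S xS).map (C.pa τ).restrict ≪
        Measure.pi fun i : C.pa τ => doRef μ S xS i := by
      have hr : Measurable ((C.pa τ).restrict : (∀ j, Ω j) → _) := Finset.measurable_restrict _
      refine ((withDensity_absolutelyContinuous _ _).map hr).trans ?_
      refine Measure.AbsolutelyContinuous.mk fun N hN hN0 => ?_
      rw [Measure.map_apply hr hN]
      exact measure_eq_zero_iff_ae_notMem.2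
        (ae_comp_restrict_of_ae _ (C.pa τ) (measure_eq_zero_iff_ae_notMem.1 hN0))
    exact h2 h1

/-- The law under the intervention, as the image of a law of the variables outside `S`. -/
lemma doLaw_eq_map (hp : Measurable p) : C.doLaw p S xS =
    ((Measure.pi fun i : (Sᶜ : Finset V) => μ i).withDensity fun y =>
      blockProd C.toChainGraph (C.doFactor p S) Finset.univ (glue S xS y)).map (glue S xS) := by
  have hD := measurable_blockProd (G := C.toChainGraph) (measurable_doFactor (C := C) (S := S) hp)
    Finset.univ
  have hg := measurable_glue (Ω := Ω) xS
  refine Measure.ext_of_lintegral _ fun f hf => ?_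
  have hDg : Measurable fun y =>
    blockProd C.toChainGraph (C.doFactor p S) Finset.univ (glue S xS y) := hD.comp hg
  have hfg : Measurable fun y => f (glue S xS y) := hf.comp hg
  rw [doLaw, pi_doRef, lintegral_withDensity_eq_lintegral_mul _ hD hf, lintegral_map (hD.mul hf) hg,
    lintegral_map hf hg, lintegral_withDensity_eq_lintegral_mul _ hDg hfg]
  rfl

lemma blockProd_glue_ae_eq
    (h : ∀ᵐ x ∂(Measure.pi (doRef μ S xS)), C.IsRegular P p x₀ x) :
    (fun y => blockProd C.toChainGraph (C.doFactor p S) Finset.univ (glue S xS y))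
      =ᵐ[Measure.pi fun i : (Sᶜ : Finset V) => μ i] C.interventionalDensity P S xS := by
  rw [pi_doRef] at h
  filter_upwards [ae_of_ae_map (measurable_glue xS).aemeasurable h] with y hy
  rw [interventionalDensity, blockProd, Finset.filter_true_of_mem (fun _ _ => Finset.subset_univ _),
    ← Finset.prod_sdiff C.confounded_subset, mul_comm]
  congr 1
  · refine Finset.prod_congr rfl fun τ hτ => ?_
    rw [doFactor, if_pos hτ, condInt_of_ne_top (hy.ne_top _), condDensity, hy.margDensity_eq,
      hy.margDensity_eq, Finset.union_comm]
  · refine Finset.prod_congr rfl fun τ hτ => ?_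
    rw [doFactor, if_neg (Finset.mem_sdiff.1 hτ).2, condInt_of_ne_top (hy.ne_top _), condDensity,
      hy.margDensity_eq, hy.margDensity_eq, Finset.union_comm]

end CausalChainGraph

end InterventionalLaw

theorem mainTheorem1 {V : Type*} [Fintype V] [DecidableEq V] {Ω : V → Type*}
    [∀ j, MeasurableSpace (Ω j)] [∀ j, StandardBorelSpace (Ω j)]
    (μ : ∀ j, Measure (Ω j)) [∀ j, SigmaFinite (μ j)]
    (C : CausalChainGraph V Ω μ) (P : Measure (∀ j, Ω j)) (hP : C.IsObservationalLaw P)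
    (hPμ : P ≪ Measure.pi μ) (hμP : Measure.pi μ ≪ P) (S : Finset V) :
    ∀ᵐ xS ∂(Measure.pi fun i : S => μ i),
      (∃! Q : Measure (∀ j, Ω j), C.IsDoLaw S xS Q) ∧
      ∀ Q : Measure (∀ j, Ω j), C.IsDoLaw S xS Q →
        (∀ᵐ x ∂Q, S.restrict x = xS) ∧
        Q.map (Sᶜ).restrict =
          (Measure.pi fun i : (Sᶜ : Finset V) => μ i).withDensity
            (C.interventionalDensity P S xS) ∧
        ∀ f : (∀ j, Ω j) → ℝ, Measurable f →
          (Integrable f Q ↔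
            Integrable (fun y => (C.interventionalDensity P S xS y).toReal * f (glue S xS y))
              (Measure.pi fun i : (Sᶜ : Finset V) => μ i)) ∧
          ∫ x, f x ∂Q =
            ∫ y, (C.interventionalDensity P S xS y).toReal * f (glue S xS y)
              ∂(Measure.pi fun i : (Sᶜ : Finset V) => μ i) := by
  have := hP.generated.prob
  obtain ⟨p, hp, hp0, hPp⟩ := exists_pos_density hPμ hμP
  have hp1 : ∫⁻ x, p x ∂(Measure.pi μ) = 1 := by
    rw [← measure_univ (μ := P), hPp, withDensity_apply _ .univ, Measure.restrict_univ]
  obtain ⟨x₀⟩ : Nonempty (∀ j, Ω j) := nonempty_of_isProbabilityMeasure P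
  filter_upwards [ae_ae_pi_doRef (CausalChainGraph.ae_isRegular hP hp hp0 hPp x₀) S] with xS hreg
  have huniq : ∀ Q, C.IsDoLaw S xS Q → Q = C.doLaw p S xS := fun Q hQ =>
    hQ.eq_doLaw hp hp0 hp1 hreg
  refine ⟨⟨_, CausalChainGraph.isDoLaw_doLaw hp hp0 hp1 hreg, huniq⟩, fun Q hQ => ?_⟩
  rw [huniq Q hQ]
  have hprob := CausalChainGraph.isProbabilityMeasure_doLaw (C := C) (S := S) (xS := xS) hp hp0 hp1 x₀
  have hg := measurable_glue (Ω := Ω) xS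
  have hD : Measurable fun y =>
      blockProd C.toChainGraph (C.doFactor p S) Finset.univ (glue S xS y) :=
    (measurable_blockProd (CausalChainGraph.measurable_doFactor hp) _).comp hg
  have hDeq := CausalChainGraph.blockProd_glue_ae_eq hreg
  have hDtop : ∀ᵐ y ∂(Measure.pi fun i : (Sᶜ : Finset V) => μ i),
      blockProd C.toChainGraph (C.doFactor p S) Finset.univ (glue S xS y) < ∞ := by
    refine ae_lt_top hD ?_
    rw [CausalChainGraph.doLaw_eq_map hp] at hprob
    have := hprob.measure_univ
    rw [Measure.map_apply hg .univ, Set.preimage_univ, withDensity_apply _ .univ,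
      Measure.restrict_univ] at this
    simp [this]
  refine ⟨?_, ?_, fun f hf => ?_⟩
  · refine (withDensity_absolutelyContinuous _ _).ae_le ?_
    filter_upwards [ae_pi_doRef_eq (μ := μ) (S := S) (xS := xS)] with x hx
    exact funext fun i => hx i i.2
  · rw [CausalChainGraph.doLaw_eq_map hp, Measure.map_map (Finset.measurable_restrict _) hg,
      ← withDensity_congr_ae hDeq]
    have : (Sᶜ : Finset V).restrict ∘ glue S xS = id := by
      ext y i
      simp [glue, Finset.mem_compl.1 i.2]
    rw [this, Measure.map_id]
  · have hmul : (fun y => (blockProd C.toChainGraph (C.doFactor p S) Finset.univ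
          (glue S xS y)).toReal • f (glue S xS y))
        =ᵐ[Measure.pi fun i : (Sᶜ : Finset V) => μ i]
        fun y => (C.interventionalDensity P S xS y).toReal * f (glue S xS y) := by
      filter_upwards [hDeq] with y hy
      rw [hy, smul_eq_mul]
    rw [CausalChainGraph.doLaw_eq_map hp, integrable_map_measure hf.aestronglyMeasurable
      hg.aemeasurable, integral_map hg.aemeasurable hf.aestronglyMeasurable,
      integrable_withDensity_iff_integrable_smul' hD hDtop,
      integral_withDensity_eq_integral_toReal_smul hD hDtop]
    exact ⟨integrable_congr hmul, integral_congr_ae hmul⟩
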